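/- For a complex number $\alpha$ and $S\subset\mathbb{C}$ put $S[\alpha]=\{\sum_{j=0}^{n}f_j\alpha^j : n\in\mathbb{N},\ f_0,\dots,f_n\in S\}$, where $\mathbb N=\{0,1,2,\dots\}$. If some finite $S\subset\mathbb{C}$ satisfies $\mathbb{Z}[\alpha]=S[\alpha]$, let $S_\alpha$ denote any such finite set with the minimal number of elements. Let $\mathcal{F}_N$ be the set of algebraic numbers $\alpha$ for which such a set exists and $\operatorname{Card}(S_\alpha)=N$. For an algebraic number $\alpha$ let $M_\alpha\in\mathbb{Z}[x]$ be its primitive minimal polynomial (a nonzero rational multiple of its minimal polynomial over $\mathbb{Q}$, with integer coefficients of greatest common divisor $1$; unique up to sign). Conjugates are taken over $\mathbb{Q}$ and include the number itself. An expanding integer is an algebraic integer all of whose conjugates have modulus greater than $1$. Theorem 2. (i) Every root of unity belongs to $\mathcal{F}_2$. If $\alpha\in\mathcal{F}_2$, then either all conjugates of $\alpha$ have modulus $1$, or $\alpha$ is an expanding integer with $|M_\alpha(0)|=2$; moreover $|M_\alpha(0)|=2$ for every $\alpha\in\mathcal{F}_2$ that is not a root of unity. (ii) If $\alpha$ is an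 algebraic number with $|M_\alpha(1)|=1$, then $\alpha\notin\mathcal{F}_{|M_\alpha(0)|}$. (iii) Let $\alpha$ be an algebraic number whose conjugates all have modulus $1$. For every choice of $S_\alpha$, if $\operatorname{Card}(S_\alpha)=|M_\alpha(0)|$, then $S_\alpha\not\subset\mathbb{Z}$. (iv) If $\alpha$ is an algebraic integer whose conjugates all have modulus greater than $2$, then $\alpha\in\mathcal{F}_{|M_\alpha(0)|}$. (v) Let $\alpha=a/b$, where $a\in\mathbb{N}$, $b\in\mathbb{Z}$, $a>|b|\ge 1$ and $\gcd(a,b)=1$. If $a\ne b+1$, then $\alpha\in\mathcal{F}_{|M_\alpha(0)|}$; if $a=b+1$, then $\alpha\in\mathcal{F}_{2|M_\alpha(0)|-1}$. In both cases $S_\alpha$ can be chosen so that $0\in S_\alpha\subset\mathbb{Z}$. -/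

import Mathlib

open Polynomial

/-- The set `S[α]` of all sums `f₀ + f₁ α + ⋯ + fₙ αⁿ` with `n ∈ ℕ` and `f₀, …, fₙ ∈ S`. -/
def digitSums (S : Set ℂ) (α : ℂ) : Set ℂ :=
  {z | ∃ (n : ℕ) (f : ℕ → ℂ), (∀ j ≤ n, f j ∈ S) ∧
    z = ∑ j ∈ Finset.range (n + 1), f j * α ^ j}

/-- `ℤ[α] = S[α]`, where `S` is a finite set of complex numbers. -/
def IsDigitSet (α : ℂ) (S : Finset ℂ) : Prop :=
  (Algebra.adjoin ℤ {α} : Set ℂ) = digitSums (S : Set ℂ) α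

/-- `S` is a possible choice for `S_α`: a finite set with `ℤ[α] = S[α]`, having the minimal
number of elements among all such sets. -/
def IsOptimalDigitSet (α : ℂ) (S : Finset ℂ) : Prop :=
  IsDigitSet α S ∧ ∀ T : Finset ℂ, IsDigitSet α T → S.card ≤ T.card

/-- The set `F_N` of the algebraic numbers `α` with `Card(S_α) = N`. -/
def setF (N : ℕ) : Set ℂ :=
  {α | IsAlgebraic ℚ α ∧ ∃ S : Finset ℂ, IsOptimalDigitSet α S ∧ S.card = N}

/-- The primitive minimal polynomial `M_α ∈ ℤ[x]` of an algebraic number `α` (determined up to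
sign): clear the denominators of the minimal polynomial over `ℚ` and divide by the content. -/
noncomputable def primMinpoly (α : ℂ) : ℤ[X] :=
  (IsLocalization.integerNormalization (nonZeroDivisors ℤ) (minpoly ℚ α)).primPart

/-- `primMinpoly α` is primitive, and is a nonzero rational multiple of the minimal polynomial. -/
theorem primMinpoly_spec (α : ℂ) :
    (primMinpoly α).IsPrimitive ∧
      (IsAlgebraic ℚ α → ∃ c : ℚ, c ≠ 0 ∧
        (primMinpoly α).map (Int.castRingHom ℚ) = C c * minpoly ℚ α) := by
  refine ⟨Polynomial.isPrimitive_primPart _, fun hα => ?_⟩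
  obtain ⟨b, hbm, hb⟩ := IsLocalization.integerNormalization_spec (nonZeroDivisors ℤ)
    (minpoly ℚ α)
  have h0 : minpoly ℚ α ≠ 0 := minpoly.ne_zero hα.isIntegral
  have hbne : (b : ℚ) ≠ 0 := by
    exact_mod_cast nonZeroDivisors.ne_zero hbm
  set P := IsLocalization.integerNormalization (nonZeroDivisors ℤ) (minpoly ℚ α) with hP
  have hb' : P.map (Int.castRingHom ℚ) = C (b : ℚ) * minpoly ℚ α := by
    rw [← algebraMap_int_eq, hb]
    ext n
    simp
  have hc : P.content ≠ 0 := by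
    intro h
    rw [Polynomial.content_eq_zero_iff] at h
    rw [h, Polynomial.map_zero] at hb'
    exact mul_ne_zero (by simpa using hbne) h0 hb'.symm
  have hcq : ((P.content : ℤ) : ℚ) ≠ 0 := by exact_mod_cast hc
  refine ⟨(b : ℚ) / (P.content : ℚ), div_ne_zero hbne hcq, ?_⟩
  have h1 : P.map (Int.castRingHom ℚ)
      = C ((P.content : ℤ) : ℚ) * P.primPart.map (Int.castRingHom ℚ) := by
    conv_lhs => rw [Polynomial.eq_C_content_mul_primPart P]
    simp
  have h2 : C ((P.content : ℤ) : ℚ) * P.primPart.map (Int.castRingHom ℚ)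
      = C ((P.content : ℤ) : ℚ) * (C ((b : ℚ) / (P.content : ℚ)) * minpoly ℚ α) := by
    rw [← h1, hb', ← mul_assoc, ← C_mul, mul_div_cancel₀ _ hcq]
  exact mul_left_cancel₀ (by simp [hc]) h2

/-- An expanding integer: an algebraic integer whose conjugates (including itself) all have
modulus greater than one. -/
def IsExpandingInteger (α : ℂ) : Prop :=
  IsIntegral ℤ α ∧ ∀ β : ℂ, IsConjRoot ℚ α β → 1 < ‖β‖

/-! ### The primitive minimal polynomial -/

/-! The quotient of `ℤ[α]` by `α ℤ[α]` is `ℤ / M_α(0)` (`memSelfIdeal_aeval_iff`), and the lowest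
digit of an expansion lies in the residue class of the number expanded. Hence a digit set has at
least `|M_α(0)|` elements. If it has exactly that many, division by `α` with remainder in `S` is a
map `T` on `ℤ[α]`, and `S` is a digit set iff every orbit of `T` reaches `0` after a positive number
of steps.

Obstructions are orbits that miss `0`. A nonzero fixed point `s / (1 - α)` in `ℤ[α]` is one
(`IsDigitSet.eq_zero_of_eq_add_mul_self`): it settles the case `|M_α(1)| = 1` and makes `α = (b + 1)
/ b` need two digits in each nonzero class. For integer digits on the unit circle, `T` is injective
on the infinite set `ℤ[α] ∩ α⁻¹ ℤ[α⁻¹]`, which therefore cannot consist of preimages of one cycle.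

Constructions are descents: choose digits so that the quotient is smaller, measured by the house
when all conjugates exceed `2` in modulus, and by an integer `|q|` for `a / b`.

For two digits, boundedness of digit sums at a conjugate inside the unit disc excludes such
conjugates; `M_α(0)` is then compared with the leading coefficient by Vieta, and Kronecker's theorem
recognises roots of unity. -/

theorem mem_adjoin_iff_exists_aeval {α z : ℂ} :
    z ∈ Algebra.adjoin ℤ {α} ↔ ∃ p : ℤ[X], aeval α p = z := by
  rw [Algebra.adjoin_singleton_eq_range_aeval, AlgHom.mem_range]

theorem aeval_C_intCast (α : ℂ) (k : ℤ) : aeval α (C k) = (k : ℂ) := by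
  simp

/-- Gauss's lemma: since `M_α` is primitive, divisibility over `ℚ` descends to `ℤ`. -/
theorem aeval_eq_zero_iff_primMinpoly_dvd {α : ℂ} (hα : IsAlgebraic ℚ α) (p : ℤ[X]) :
    aeval α p = 0 ↔ primMinpoly α ∣ p := by
  obtain ⟨hprim, h⟩ := primMinpoly_spec α
  obtain ⟨c, hc, hM⟩ := h hα
  rw [IsPrimitive.Int.dvd_iff_map_cast_dvd_map_cast _ _ hprim, hM,
    (isUnit_C.2 hc.isUnit).mul_left_dvd, minpoly.dvd_iff, ← algebraMap_int_eq,
    aeval_map_algebraMap]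

theorem primMinpoly_ne_zero (α : ℂ) : primMinpoly α ≠ 0 :=
  (primMinpoly_spec α).1.ne_zero

theorem aeval_primMinpoly {α : ℂ} (hα : IsAlgebraic ℚ α) : aeval α (primMinpoly α) = 0 :=
  (aeval_eq_zero_iff_primMinpoly_dvd hα _).2 dvd_rfl

theorem IsConjRoot.primMinpoly_eq {α β : ℂ} (h : IsConjRoot ℚ α β) :
    primMinpoly β = primMinpoly α := by
  unfold primMinpoly
  rw [isConjRoot_def.1 h]

theorem IsConjRoot.isAlgebraic {α β : ℂ} (h : IsConjRoot ℚ α β) (hα : IsAlgebraic ℚ α) :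
    IsAlgebraic ℚ β :=
  (h.isIntegral hα.isIntegral).isAlgebraic

theorem IsConjRoot.aeval_int_eq_zero {α β : ℂ} (h : IsConjRoot ℚ α β) (hα : IsAlgebraic ℚ α)
    {p : ℤ[X]} (hp : aeval α p = 0) : aeval β p = 0 := by
  rw [aeval_eq_zero_iff_primMinpoly_dvd (h.isAlgebraic hα), h.primMinpoly_eq]
  exact (aeval_eq_zero_iff_primMinpoly_dvd hα p).1 hp

theorem isConjRoot_of_aeval_primMinpoly {α β : ℂ} (hα : IsAlgebraic ℚ α)
    (h : aeval β (primMinpoly α) = 0) : IsConjRoot ℚ α β := by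
  obtain ⟨c, hc, hM⟩ := (primMinpoly_spec α).2 hα
  refine isConjRoot_of_aeval_eq_zero hα.isIntegral ?_
  have h1 : aeval β ((primMinpoly α).map (algebraMap ℤ ℚ)) = 0 := by
    rwa [aeval_map_algebraMap]
  rw [algebraMap_int_eq, hM, map_mul, aeval_C] at h1
  exact (mul_eq_zero.1 h1).resolve_left (by simpa using hc)

theorem eval_zero_primMinpoly_ne_zero {α : ℂ} (hα : IsAlgebraic ℚ α) (h0 : α ≠ 0) :
    (primMinpoly α).eval 0 ≠ 0 := by
  intro h
  have : IsConjRoot ℚ α 0 := isConjRoot_of_aeval_primMinpoly hα (by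
    rw [aeval_def, eval₂_at_zero, coeff_zero_eq_eval_zero, h, map_zero])
  exact h0 ((isConjRoot_zero_iff_eq_zero' (K := ℚ)).1 this)

/-! ### Divisibility by `α` in `ℤ[α]` -/

/-- `z` lies in the ideal `α ℤ[α]` of `ℤ[α]`. -/
def MemSelfIdeal (α z : ℂ) : Prop :=
  ∃ y ∈ Algebra.adjoin ℤ {α}, z = α * y

namespace MemSelfIdeal

variable {α z w : ℂ}

theorem neg (h : MemSelfIdeal α z) : MemSelfIdeal α (-z) := by
  obtain ⟨y, hy, rfl⟩ := h
  exact ⟨-y, neg_mem hy, by ring⟩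

theorem add (h : MemSelfIdeal α z) (h' : MemSelfIdeal α w) : MemSelfIdeal α (z + w) := by
  obtain ⟨y, hy, rfl⟩ := h
  obtain ⟨x, hx, rfl⟩ := h'
  exact ⟨y + x, add_mem hy hx, by ring⟩

theorem sub (h : MemSelfIdeal α z) (h' : MemSelfIdeal α w) : MemSelfIdeal α (z - w) := by
  rw [sub_eq_add_neg]
  exact h.add h'.neg

end MemSelfIdeal

/-- Both sides say that `p` lies in the ideal `(M_α, X)` of `ℤ[X]`. -/
theorem memSelfIdeal_aeval_iff {α : ℂ} (hα : IsAlgebraic ℚ α) (p : ℤ[X]) :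
    MemSelfIdeal α (aeval α p) ↔ (primMinpoly α).eval 0 ∣ p.eval 0 := by
  constructor
  · rintro ⟨y, hy, h⟩
    obtain ⟨q, rfl⟩ := mem_adjoin_iff_exists_aeval.1 hy
    obtain ⟨r, hr⟩ := (aeval_eq_zero_iff_primMinpoly_dvd hα (p - X * q)).1 (by simp [h])
    refine ⟨r.eval 0, ?_⟩
    simpa using congrArg (eval 0) hr
  · rintro ⟨k, hk⟩
    obtain ⟨q, hq⟩ : X ∣ p - primMinpoly α * C k := by
      rw [X_dvd_iff, coeff_zero_eq_eval_zero]
      simp [hk]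
    refine ⟨aeval α q, mem_adjoin_iff_exists_aeval.2 ⟨q, rfl⟩, ?_⟩
    have := congrArg (aeval α) hq
    simpa [aeval_primMinpoly hα] using this

theorem memSelfIdeal_intCast_iff {α : ℂ} (hα : IsAlgebraic ℚ α) (k : ℤ) :
    MemSelfIdeal α k ↔ (primMinpoly α).eval 0 ∣ k := by
  simpa using memSelfIdeal_aeval_iff hα (C k)

theorem exists_nat_memSelfIdeal_sub {α : ℂ} (hα : IsAlgebraic ℚ α) (h0 : α ≠ 0) {z : ℂ}
    (hz : z ∈ Algebra.adjoin ℤ {α}) :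
    ∃ k < ((primMinpoly α).eval 0).natAbs, MemSelfIdeal α (z - k) := by
  obtain ⟨p, rfl⟩ := mem_adjoin_iff_exists_aeval.1 hz
  have hN := eval_zero_primMinpoly_ne_zero hα h0
  set N := (primMinpoly α).eval 0 with hNdef
  have hk0 := Int.emod_nonneg (p.eval 0) hN
  have hk1 := Int.emod_lt (p.eval 0) hN
  refine ⟨(p.eval 0 % N).toNat, by omega, ?_⟩
  have hcast : ((p.eval 0 % N).toNat : ℤ) = p.eval 0 % N := Int.toNat_of_nonneg hk0
  have : aeval α p - ((p.eval 0 % N).toNat : ℂ) = aeval α (p - C (p.eval 0 % N)) := by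
    have hcast' : ((p.eval 0 % N).toNat : ℂ) = ((p.eval 0 % N : ℤ) : ℂ) := by
      exact_mod_cast congrArg (Int.cast : ℤ → ℂ) hcast
    rw [map_sub, aeval_C, hcast']
    rfl
  rw [this, memSelfIdeal_aeval_iff hα]
  simpa using Int.dvd_self_sub_emod

theorem natCast_eq_of_memSelfIdeal_sub {α : ℂ} (hα : IsAlgebraic ℚ α) {k l : ℕ}
    (hk : k < ((primMinpoly α).eval 0).natAbs) (hl : l < ((primMinpoly α).eval 0).natAbs)
    (h : MemSelfIdeal α ((k : ℂ) - l)) : k = l := by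
  have h1 : MemSelfIdeal α (((k : ℤ) - l : ℤ) : ℂ) := by simpa using h
  rw [memSelfIdeal_intCast_iff hα] at h1
  by_contra hne
  have := Int.natAbs_le_of_dvd_ne_zero h1 (by omega)
  omega

/-! ### Digit sums -/

theorem mem_digitSums_self {S : Set ℂ} {α s : ℂ} (hs : s ∈ S) : s ∈ digitSums S α :=
  ⟨0, fun _ => s, fun _ _ => hs, by simp⟩

theorem add_mul_mem_digitSums {S : Set ℂ} {α s y : ℂ} (hs : s ∈ S) (hy : y ∈ digitSums S α) :
    s + α * y ∈ digitSums S α := by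
  obtain ⟨n, f, hf, rfl⟩ := hy
  refine ⟨n + 1, fun j => if j = 0 then s else f (j - 1), fun j hj => ?_, ?_⟩
  · dsimp only
    split_ifs with h
    · exact hs
    · exact hf _ (by omega)
  · rw [Finset.sum_range_succ' _ (n + 1), Finset.mul_sum, add_comm]
    simp only [Nat.add_eq_zero_iff, one_ne_zero, and_false, if_false, Nat.add_sub_cancel,
      if_true, pow_zero, mul_one]
    congr 1
    exact Finset.sum_congr rfl fun j _ => by ring

/-- Horner's scheme. The base case is a single digit rather than `0`, because empty digit sums are
not admitted. -/
theorem digitSums_induction {S : Set ℂ} {α : ℂ} {P : ℂ → Prop} (base : ∀ s ∈ S, P s)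
    (step : ∀ s ∈ S, ∀ y ∈ digitSums S α, P y → P (s + α * y)) {z : ℂ}
    (hz : z ∈ digitSums S α) : P z := by
  obtain ⟨n, f, hf, rfl⟩ := hz
  induction n generalizing f with
  | zero => simpa using base _ (hf 0 le_rfl)
  | succ n ih =>
    have hf' : ∀ j ≤ n, f (j + 1) ∈ S := fun j hj => hf _ (by omega)
    have h := step (f 0) (hf 0 (by omega)) _ ⟨n, fun j => f (j + 1), hf', rfl⟩
      (ih (fun j => f (j + 1)) hf')
    convert h using 1
    rw [Finset.sum_range_succ' _ (n + 1), Finset.mul_sum, add_comm]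
    congr 1
    · simp
    · exact Finset.sum_congr rfl fun j _ => by ring

/-- Every digit sum consists of a first digit and a remainder, which is `0` or a digit sum. -/
theorem digitSums_cases {S : Set ℂ} {α z : ℂ} (hz : z ∈ digitSums S α) :
    ∃ s ∈ S, ∃ y, (y = 0 ∨ y ∈ digitSums S α) ∧ z = s + α * y :=
  digitSums_induction (P := fun z => ∃ s ∈ S, ∃ y, (y = 0 ∨ y ∈ digitSums S α) ∧ z = s + α * y)
    (fun s hs => ⟨s, hs, 0, Or.inl rfl, by simp⟩)
    (fun s hs y hy _ => ⟨s, hs, y, Or.inr hy, rfl⟩) hz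

theorem self_mem_adjoin (α : ℂ) : α ∈ Algebra.adjoin ℤ {α} :=
  Algebra.self_mem_adjoin_singleton ℤ α

theorem intCast_mem_adjoin (α : ℂ) (k : ℤ) : (k : ℂ) ∈ Algebra.adjoin ℤ {α} :=
  intCast_mem _ k

theorem digitSums_subset_adjoin {S : Set ℂ} {α : ℂ}
    (hS : ∀ s ∈ S, s ∈ Algebra.adjoin ℤ {α}) {z : ℂ} (hz : z ∈ digitSums S α) :
    z ∈ Algebra.adjoin ℤ {α} :=
  digitSums_induction (P := (· ∈ Algebra.adjoin ℤ {α})) hS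
    (fun s hs _ _ hy => add_mem (hS s hs) (Subalgebra.mul_mem _ (self_mem_adjoin α) hy)) hz

theorem isDigitSet_of_forall_mem {S : Finset ℂ} {α : ℂ}
    (hS : ∀ s ∈ S, s ∈ Algebra.adjoin ℤ {α})
    (h : ∀ z ∈ Algebra.adjoin ℤ {α}, z ∈ digitSums (S : Set ℂ) α) : IsDigitSet α S :=
  Set.Subset.antisymm h fun _ hz => digitSums_subset_adjoin (by simpa using hS) hz

/-- If every element of `ℤ[α]` can be divided by `α` with remainder in `S` such that the quotient
vanishes or has smaller measure, then `S` is a digit set. -/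
theorem isDigitSet_of_measure {S : Finset ℂ} {α : ℂ} (μ : ℂ → ℕ)
    (hS : ∀ s ∈ S, s ∈ Algebra.adjoin ℤ {α})
    (h : ∀ z ∈ Algebra.adjoin ℤ {α}, ∃ s ∈ S, ∃ y ∈ Algebra.adjoin ℤ {α},
      z = s + α * y ∧ (y = 0 ∨ μ y < μ z)) : IsDigitSet α S := by
  refine isDigitSet_of_forall_mem hS fun z => ?_
  induction hn : μ z using Nat.strong_induction_on generalizing z with
  | _ n ih =>
    intro hz
    obtain ⟨s, hs, y, hy, rfl, h0 | hlt⟩ := h z hz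
    · subst h0
      simpa using mem_digitSums_self (α := α) (Finset.mem_coe.2 hs)
    · exact add_mul_mem_digitSums (Finset.mem_coe.2 hs) (ih _ (hn ▸ hlt) y rfl hy)

/-! ### Residue classes of digits. -/

namespace IsDigitSet

variable {α : ℂ} {S : Finset ℂ}

theorem mem_digitSums (h : IsDigitSet α S) {z : ℂ} (hz : z ∈ Algebra.adjoin ℤ {α}) :
    z ∈ digitSums (S : Set ℂ) α := by
  have : z ∈ (Algebra.adjoin ℤ {α} : Set ℂ) := hz
  rwa [h] at this

theorem mem_adjoin (h : IsDigitSet α S) {s : ℂ} (hs : s ∈ S) : s ∈ Algebra.adjoin ℤ {α} := by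
  have : s ∈ digitSums (S : Set ℂ) α := mem_digitSums_self (Finset.mem_coe.2 hs)
  rw [← h] at this
  exact this

theorem exists_eq_add_mul (h : IsDigitSet α S) {z : ℂ} (hz : z ∈ Algebra.adjoin ℤ {α}) :
    ∃ s ∈ S, ∃ y ∈ Algebra.adjoin ℤ {α}, z = s + α * y := by
  obtain ⟨s, hs, y, hy, hz⟩ := digitSums_cases (h.mem_digitSums hz)
  refine ⟨s, hs, y, ?_, hz⟩
  rcases hy with rfl | hy
  · exact zero_mem _
  · exact digitSums_subset_adjoin (fun t ht => h.mem_adjoin ht) hy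

theorem exists_memSelfIdeal_sub (h : IsDigitSet α S) {z : ℂ} (hz : z ∈ Algebra.adjoin ℤ {α}) :
    ∃ s ∈ S, MemSelfIdeal α (s - z) := by
  obtain ⟨s, hs, y, hy, rfl⟩ := h.exists_eq_add_mul hz
  exact ⟨s, hs, -y, neg_mem hy, by ring⟩

theorem nonempty (h : IsDigitSet α S) : S.Nonempty := by
  obtain ⟨s, hs, -⟩ := h.exists_memSelfIdeal_sub (zero_mem _)
  exact ⟨s, hs⟩

/-- A digit set covers all residue classes modulo `α`. -/
theorem natAbs_eval_zero_le_card (h : IsDigitSet α S) (hα : IsAlgebraic ℚ α) :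
    ((primMinpoly α).eval 0).natAbs ≤ S.card := by
  choose f hf hf' using fun k : ℕ => h.exists_memSelfIdeal_sub (intCast_mem_adjoin α k)
  have := Finset.card_le_card_of_injOn (s := Finset.range ((primMinpoly α).eval 0).natAbs) f
    (fun k _ => hf k) (fun k hk l hl hkl => ?_)
  · simpa using this
  · refine natCast_eq_of_memSelfIdeal_sub hα (by simpa using hk) (by simpa using hl) ?_
    have := (hf' l).sub (hf' k)
    rw [hkl] at this
    simpa using this

/-- The digits of a digit set of cardinality `|M_α(0)|` are distinct modulo `α`. -/
theorem eq_of_memSelfIdeal_sub (h : IsDigitSet α S) (hα : IsAlgebraic ℚ α)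
    (hcard : S.card = ((primMinpoly α).eval 0).natAbs) {s t : ℂ} (hs : s ∈ S) (ht : t ∈ S)
    (hst : MemSelfIdeal α (s - t)) : s = t := by
  choose f hf hf' using fun k : ℕ => h.exists_memSelfIdeal_sub (intCast_mem_adjoin α k)
  have hinj : Set.InjOn f (Finset.range ((primMinpoly α).eval 0).natAbs) := fun k hk l hl hkl => by
    refine natCast_eq_of_memSelfIdeal_sub hα (by simpa using hk) (by simpa using hl) ?_
    have := (hf' l).sub (hf' k)
    rw [hkl] at this
    simpa using this
  have hsurj := Finset.surjOn_of_injOn_of_card_le f (fun k _ => hf k) hinj (by simp [hcard])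
  obtain ⟨k, hk, rfl⟩ := hsurj (Finset.mem_coe.2 hs)
  obtain ⟨l, hl, rfl⟩ := hsurj (Finset.mem_coe.2 ht)
  congr 1
  refine natCast_eq_of_memSelfIdeal_sub hα (by simpa using hk) (by simpa using hl) ?_
  have := (hst.sub (hf' k)).add (hf' l)
  simpa using this

theorem isOptimalDigitSet (h : IsDigitSet α S) (hα : IsAlgebraic ℚ α)
    (hcard : S.card ≤ ((primMinpoly α).eval 0).natAbs) : IsOptimalDigitSet α S :=
  ⟨h, fun _ hT => hcard.trans (hT.natAbs_eval_zero_le_card hα)⟩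

theorem mem_setF (h : IsDigitSet α S) (hα : IsAlgebraic ℚ α)
    (hcard : S.card ≤ ((primMinpoly α).eval 0).natAbs) :
    α ∈ setF ((primMinpoly α).eval 0).natAbs :=
  ⟨hα, S, h.isOptimalDigitSet hα hcard, le_antisymm hcard (h.natAbs_eval_zero_le_card hα)⟩

/-- In base `0` a sum equals its lowest digit, so every integer would be a digit. -/
theorem ne_zero (h : IsDigitSet α S) : α ≠ 0 := by
  rintro rfl
  have hsub : Set.range (fun k : ℤ => (k : ℂ)) ⊆ (S : Set ℂ) := by
    rintro _ ⟨k, rfl⟩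
    obtain ⟨s, hs, y, -, hz⟩ := h.exists_eq_add_mul (intCast_mem_adjoin 0 k)
    simpa [hz] using hs
  exact Set.infinite_range_of_injective Int.cast_injective (S.finite_toSet.subset hsub)

theorem exists_ne_zero (h : IsDigitSet α S) : ∃ s ∈ S, s ≠ 0 := by
  by_contra! h0
  have : (1 : ℂ) = 0 := digitSums_induction (P := (· = 0)) (fun s hs => h0 s hs)
    (fun s hs y _ hy => by simp [h0 s hs, hy]) (h.mem_digitSums (one_mem _))
  exact one_ne_zero this

end IsDigitSet

/-! ### Fixed points, and the position of the conjugates. -/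

namespace IsDigitSet

variable {α : ℂ} {S : Finset ℂ}

/-- If `s` is the only digit in its residue class modulo `α`, then a point `z` that is fixed by
the division with digit `s` has no digit expansion, unless `z = 0`. -/
theorem eq_zero_of_eq_add_mul_self (h : IsDigitSet α S) {s z : ℂ}
    (hz : z ∈ Algebra.adjoin ℤ {α}) (hzs : z = s + α * z)
    (huniq : ∀ t ∈ S, MemSelfIdeal α (t - s) → t = s) : z = 0 := by
  have hα0 := h.ne_zero
  -- Any expansion of `z` must start with `s` and leaves `z` again; at its last digit this gives `α
  -- * z = 0`.
  refine digitSums_induction (S := (S : Set ℂ)) (α := α) (P := fun w => w = z → z = 0)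
    (fun t ht htz => ?_) (fun t ht y hy ih htz => ?_) (h.mem_digitSums hz) rfl
  · have hts : t = s := huniq t ht ⟨z, hz, by rw [htz]; linear_combination hzs⟩
    have : α * z = 0 := by linear_combination hts - htz - hzs
    exact (mul_eq_zero.1 this).resolve_left hα0
  · have hy' : y ∈ Algebra.adjoin ℤ {α} :=
      digitSums_subset_adjoin (fun r hr => h.mem_adjoin hr) hy
    have hts : t = s := huniq t ht ⟨z - y, sub_mem hz hy', by linear_combination htz + hzs⟩
    refine ih (mul_left_cancel₀ hα0 ?_)
    linear_combination htz - hts + hzs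

/-- `M_α(1) = ±1` makes `1 - α` a unit of `ℤ[α]`, with inverse `e * aeval α q` below. So the fixed
point `s / (1 - α)` of division with a nonzero digit `s` lies in `ℤ[α]`. -/
theorem card_ne_of_natAbs_eval_one (h : IsDigitSet α S) (hα : IsAlgebraic ℚ α)
    (h1 : |(primMinpoly α).eval 1| = 1) : S.card ≠ ((primMinpoly α).eval 0).natAbs := by
  intro hcard
  obtain ⟨s, hs, hs0⟩ := h.exists_ne_zero
  set e := (primMinpoly α).eval 1 with he
  have he2 : (e : ℂ) * e = 1 := by
    have : e * e = 1 := by rw [← abs_mul_abs_self, h1, one_mul]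
    exact_mod_cast this
  obtain ⟨q, hq⟩ := X_sub_C_dvd_sub_C_eval (a := (1 : ℤ)) (p := primMinpoly α)
  have hq' : -(e : ℂ) = (α - 1) * aeval α q := by
    have := congrArg (aeval α) hq
    simpa [aeval_primMinpoly hα] using this
  have hz : s * (e * aeval α q) ∈ Algebra.adjoin ℤ {α} :=
    Subalgebra.mul_mem _ (h.mem_adjoin hs) (Subalgebra.mul_mem _ (intCast_mem_adjoin α e)
      (mem_adjoin_iff_exists_aeval.2 ⟨q, rfl⟩))
  have hfix : s * (e * aeval α q) = s + α * (s * (e * aeval α q)) := by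
    linear_combination (s * e) * hq' + s * he2
  have h0 := h.eq_zero_of_eq_add_mul_self hz hfix
    (fun t ht hts => h.eq_of_memSelfIdeal_sub hα hcard ht hs hts)
  rw [h0] at hfix
  exact hs0 (by linear_combination -hfix)

/-- A digit set has at least two elements. -/
theorem two_le_card (h : IsDigitSet α S) : 2 ≤ S.card := by
  by_contra! hlt
  have hcard : S.card = 1 := le_antisymm (by omega) h.nonempty.card_pos
  obtain ⟨s, rfl⟩ := Finset.card_eq_one.1 hcard
  have hs : s ≠ 0 := by simpa using h.exists_ne_zero
  have hform : ∀ z ∈ Algebra.adjoin ℤ {α}, ∃ n : ℕ,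
      z = s * ∑ j ∈ Finset.range (n + 1), α ^ j := fun z hz => by
    obtain ⟨n, f, hf, rfl⟩ := h.mem_digitSums hz
    refine ⟨n, ?_⟩
    rw [Finset.mul_sum]
    refine Finset.sum_congr rfl fun j hj => ?_
    rw [show f j = s by simpa using hf j (Nat.lt_succ_iff.1 (Finset.mem_range.1 hj))]
  -- Expanding `0` forces `α` to be a root of unity other than `1`; then all digit sums are bounded
  -- by `2 * ‖s‖ / ‖α - 1‖`, but the natural numbers are not.
  obtain ⟨m, hm⟩ := hform 0 (zero_mem _)
  have hsum := (mul_eq_zero.1 hm.symm).resolve_left hs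
  have h1 : α ≠ 1 := by
    rintro rfl
    simp only [one_pow, Finset.sum_const, Finset.card_range, nsmul_eq_mul, mul_one] at hsum
    exact Nat.cast_add_one_ne_zero m (by simpa using hsum)
  have hpow : α ^ (m + 1) = 1 := by
    rw [geom_sum_eq h1, div_eq_zero_iff] at hsum
    exact sub_eq_zero.1 (hsum.resolve_right (sub_ne_zero.2 h1))
  have hnorm : ‖α‖ = 1 := Complex.norm_eq_one_of_pow_eq_one hpow (Nat.succ_ne_zero m)
  obtain ⟨k, hk⟩ := exists_nat_gt (‖s‖ * (2 / ‖α - 1‖))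
  obtain ⟨n, hn⟩ := hform k (natCast_mem _ k)
  refine absurd hk (not_lt.2 ?_)
  have := congrArg norm hn
  rw [Complex.norm_natCast, norm_mul, geom_sum_eq h1, norm_div] at this
  rw [this]
  gcongr
  calc ‖α ^ (n + 1) - 1‖ ≤ ‖α ^ (n + 1)‖ + ‖(1 : ℂ)‖ := norm_sub_le _ _
    _ = 2 := by rw [norm_pow, hnorm]; norm_num

/-- All conjugates of a number with a digit set lie outside the open unit disc. -/
theorem one_le_norm_of_isConjRoot (h : IsDigitSet α S) (hα : IsAlgebraic ℚ α) {β : ℂ}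
    (hβ : IsConjRoot ℚ α β) : 1 ≤ ‖β‖ := by
  by_contra! hlt
  have hp : ∀ s : S, ∃ p : ℤ[X], aeval α p = s := fun s =>
    mem_adjoin_iff_exists_aeval.1 (h.mem_adjoin s.2)
  choose p hp using hp
  set B : ℝ := ∑ s : S, ‖aeval β (p s)‖ with hB
  have hpB : ∀ s : S, ‖aeval β (p s)‖ ≤ B := fun s =>
    Finset.single_le_sum (f := fun s : S => ‖aeval β (p s)‖) (fun _ _ => norm_nonneg _)
      (Finset.mem_univ s)
  have hB0 : 0 ≤ B := Finset.sum_nonneg fun _ _ => norm_nonneg _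
  have h1 : 0 < 1 - ‖β‖ := by linarith
  -- The bound is the geometric series `B * ∑ ‖β‖ ^ j`, the solution of `x = B + ‖β‖ * x`. It is
  -- carried by polynomials, so that an identity at `α` can be transferred to `β`.
  have hBle : B ≤ B / (1 - ‖β‖) := by
    rw [le_div_iff₀ h1]
    nlinarith [norm_nonneg β]
  have key : ∀ z ∈ digitSums (S : Set ℂ) α,
      ∃ q : ℤ[X], aeval α q = z ∧ ‖aeval β q‖ ≤ B / (1 - ‖β‖) := fun z hz => by
    refine digitSums_induction (S := (S : Set ℂ)) (α := α)
      (P := fun z => ∃ q : ℤ[X], aeval α q = z ∧ ‖aeval β q‖ ≤ B / (1 - ‖β‖))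
      (fun s hs => ⟨p ⟨s, hs⟩, hp _, (hpB _).trans hBle⟩) ?_ hz
    rintro s hs _ - ⟨q, rfl, hq⟩
    refine ⟨p ⟨s, hs⟩ + X * q, by simp [hp], ?_⟩
    calc ‖aeval β (p ⟨s, hs⟩ + X * q)‖ ≤ ‖aeval β (p ⟨s, hs⟩)‖ + ‖β‖ * ‖aeval β q‖ := by
          rw [map_add, map_mul, aeval_X, ← norm_mul]
          exact norm_add_le _ _
      _ ≤ B + ‖β‖ * (B / (1 - ‖β‖)) := by
          gcongr
          exact hpB _
      _ = B / (1 - ‖β‖) := by field_simp; ring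
  obtain ⟨k, hk⟩ := exists_nat_gt (B / (1 - ‖β‖))
  obtain ⟨q, hq, hqB⟩ := key k (h.mem_digitSums (natCast_mem _ k))
  have h0 := hβ.aeval_int_eq_zero hα (p := q - C (k : ℤ)) (by simp [hq])
  have hqk : aeval β q = k := by simpa [sub_eq_zero] using h0
  rw [hqk, Complex.norm_natCast] at hqB
  exact absurd hk (not_lt.2 hqB)

/-- The conjugates of a number with a digit set lie all on, or all outside, the unit circle. -/
theorem forall_norm_eq_one_or_forall_one_lt_norm (h : IsDigitSet α S) (hα : IsAlgebraic ℚ α) :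
    (∀ β : ℂ, IsConjRoot ℚ α β → ‖β‖ = 1) ∨ ∀ β : ℂ, IsConjRoot ℚ α β → 1 < ‖β‖ := by
  by_cases hex : ∃ β : ℂ, IsConjRoot ℚ α β ∧ ‖β‖ = 1
  · left
    obtain ⟨β, hβ, hβ1⟩ := hex
    intro γ hγ
    refine le_antisymm ?_ (h.one_le_norm_of_isConjRoot hα hγ)
    have hβ0 : β ≠ 0 := norm_ne_zero_iff.1 (by rw [hβ1]; exact one_ne_zero)
    have hγ0 : γ ≠ 0 := hγ.ne_zero h.ne_zero
    -- On the unit circle inversion is complex conjugation, so `β` is also a root of the reversed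
    -- polynomial. Then so is every conjugate `γ`: both `γ` and `γ⁻¹` are conjugates, and both have
    -- modulus at least `1`.
    have hinv : β⁻¹ = (starRingEnd ℂ) β := by
      rw [Complex.inv_def, Complex.normSq_eq_norm_sq, hβ1]
      simp
    have hroot : aeval β⁻¹ (primMinpoly α) = 0 := by
      have h0 : aeval β (primMinpoly α) = 0 := hβ.aeval_int_eq_zero hα (aeval_primMinpoly hα)
      have := congrArg (starRingEnd ℂ) h0
      rwa [map_zero, aeval_def, hom_eval₂, ← hinv,
        Subsingleton.elim ((starRingEnd ℂ).comp (algebraMap ℤ ℂ)) (algebraMap ℤ ℂ)] at this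
    have hrev : aeval β (primMinpoly α).reverse = 0 := by
      let _ := invertibleOfNonzero (inv_ne_zero hβ0)
      have := (eval₂_reverse_eq_zero_iff (algebraMap ℤ ℂ) β⁻¹ (primMinpoly α)).2 hroot
      simpa [aeval_def] using this
    have hrevγ : aeval γ (primMinpoly α).reverse = 0 :=
      (hβ.symm.trans hγ).aeval_int_eq_zero (hβ.isAlgebraic hα) hrev
    have hγroot : aeval γ⁻¹ (primMinpoly α) = 0 := by
      let _ := invertibleOfNonzero (inv_ne_zero hγ0)
      refine (eval₂_reverse_eq_zero_iff (algebraMap ℤ ℂ) γ⁻¹ (primMinpoly α)).1 ?_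
      simpa [aeval_def] using hrevγ
    have := h.one_le_norm_of_isConjRoot hα (isConjRoot_of_aeval_primMinpoly hα hγroot)
    rw [norm_inv] at this
    exact (one_le_inv₀ (norm_pos_iff.2 hγ0)).1 this
  · right
    push Not at hex
    exact fun β hβ => lt_of_le_of_ne (h.one_le_norm_of_isConjRoot hα hβ) (hex β hβ).symm

end IsDigitSet

/-! ### Constant and leading coefficients -/

/-- Vieta, with `s` the multiset of complex roots. That `s ≠ 0` is what makes
`abs_leadingCoeff_lt_abs_eval_zero` strict. -/
theorem abs_eval_zero_primMinpoly {α : ℂ} (hα : IsAlgebraic ℚ α) :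
    ∃ s : Multiset ℂ, s ≠ 0 ∧ (∀ β ∈ s, IsConjRoot ℚ α β) ∧
      ((|(primMinpoly α).eval 0| : ℤ) : ℝ) =
        |((primMinpoly α).leadingCoeff : ℝ)| * (s.map (‖·‖)).prod := by
  set P := (primMinpoly α).map (Int.castRingHom ℂ) with hP
  have hP0 : P ≠ 0 := by
    rw [hP, Ne, Polynomial.map_eq_zero_iff (RingHom.injective_int _)]
    exact primMinpoly_ne_zero α
  have hmem : ∀ β : ℂ, β ∈ P.roots ↔ aeval β (primMinpoly α) = 0 := fun β => by
    rw [mem_roots hP0, IsRoot.def, hP, eval_map, aeval_def, algebraMap_int_eq]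
  refine ⟨P.roots, ?_, fun β hβ => isConjRoot_of_aeval_primMinpoly hα ((hmem β).1 hβ), ?_⟩
  · exact fun h0 => Multiset.notMem_zero α (h0 ▸ (hmem α).2 (aeval_primMinpoly hα))
  · have h := (IsAlgClosed.splits P).coeff_zero_eq_leadingCoeff_mul_prod_roots
    have h2 := congrArg norm h
    rw [hP, coeff_map, leadingCoeff_map_of_injective (RingHom.injective_int _), ← hP,
      coeff_zero_eq_eval_zero, norm_mul, norm_mul, norm_pow, norm_neg, norm_one, one_pow,
      one_mul, eq_intCast, eq_intCast, Complex.norm_intCast, Complex.norm_intCast] at h2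
    rw [Int.cast_abs, h2]
    congr 1
    exact map_multiset_prod (normHom : ℂ →*₀ ℝ) P.roots

theorem abs_eval_zero_eq_abs_leadingCoeff {α : ℂ} (hα : IsAlgebraic ℚ α)
    (h : ∀ β : ℂ, IsConjRoot ℚ α β → ‖β‖ = 1) :
    |(primMinpoly α).eval 0| = |(primMinpoly α).leadingCoeff| := by
  obtain ⟨s, -, hs, hprod⟩ := abs_eval_zero_primMinpoly hα
  have : (s.map (‖·‖)).prod = 1 := Multiset.prod_eq_one fun x hx => by
    obtain ⟨β, hβ, rfl⟩ := Multiset.mem_map.1 hx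
    exact h β (hs β hβ)
  rw [this, mul_one] at hprod
  exact_mod_cast hprod

theorem abs_leadingCoeff_lt_abs_eval_zero {α : ℂ} (hα : IsAlgebraic ℚ α)
    (h : ∀ β : ℂ, IsConjRoot ℚ α β → 1 < ‖β‖) :
    |(primMinpoly α).leadingCoeff| < |(primMinpoly α).eval 0| := by
  obtain ⟨s, hs0, hs, hprod⟩ := abs_eval_zero_primMinpoly hα
  have key : ∀ t : Multiset ℂ, (∀ β ∈ t, 1 < ‖β‖) → 1 ≤ (t.map (‖·‖)).prod := fun t ht =>
    Multiset.prod_induction (1 ≤ ·) _ (fun _ _ => one_le_mul_of_one_le_of_one_le) le_rfl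
      fun x hx => by
        obtain ⟨β, hβ, rfl⟩ := Multiset.mem_map.1 hx
        exact (ht β hβ).le
  obtain ⟨β, hβ⟩ := Multiset.exists_mem_of_ne_zero hs0
  obtain ⟨t, rfl⟩ := Multiset.exists_cons_of_mem hβ
  have h1 : 1 < ((β ::ₘ t).map (‖·‖)).prod := by
    rw [Multiset.map_cons, Multiset.prod_cons]
    exact one_lt_mul_of_lt_of_le (h β (hs β hβ))
      (key t fun γ hγ => h γ (hs γ (Multiset.mem_cons_of_mem hγ)))
  have hl : 0 < |((primMinpoly α).leadingCoeff : ℝ)| :=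
    abs_pos.2 (by exact_mod_cast leadingCoeff_ne_zero.2 (primMinpoly_ne_zero α))
  have h2 := lt_mul_of_one_lt_right hl h1
  rw [← hprod] at h2
  exact_mod_cast h2

theorem isIntegral_of_abs_leadingCoeff {α : ℂ} (hα : IsAlgebraic ℚ α)
    (h : |(primMinpoly α).leadingCoeff| = 1) : IsIntegral ℤ α := by
  set c := (primMinpoly α).leadingCoeff with hc
  refine ⟨C c * primMinpoly α, ?_, ?_⟩
  · rw [Monic, leadingCoeff_mul, leadingCoeff_C, ← hc, ← abs_mul_abs_self, h, one_mul]
  · rw [← aeval_def, map_mul, aeval_primMinpoly hα, mul_zero]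

-- Turns hypotheses on conjugates into hypotheses on the embeddings of `ℚ⟮α⟯`, as needed for
-- Kronecker's theorem and for the house.
open IntermediateField in
theorem isConjRoot_map_gen {α : ℂ} (φ : ℚ⟮α⟯ →+* ℂ) (hα : IsAlgebraic ℚ α) :
    IsConjRoot ℚ α (φ (AdjoinSimple.gen ℚ α)) := by
  refine isConjRoot_of_aeval_primMinpoly hα ?_
  have h0 : aeval (AdjoinSimple.gen ℚ α) (primMinpoly α) = 0 := by
    apply (algebraMap ℚ⟮α⟯ ℂ).injective
    rw [← aeval_algebraMap_apply, AdjoinSimple.algebraMap_gen, map_zero, aeval_primMinpoly hα]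
  have := congrArg φ h0
  rwa [map_zero, aeval_def, hom_eval₂,
    Subsingleton.elim (φ.comp (algebraMap ℤ ℚ⟮α⟯)) (algebraMap ℤ ℂ)] at this

open IntermediateField in
/-- Kronecker's theorem for complex numbers. -/
theorem exists_pow_eq_one_of_forall_isConjRoot {α : ℂ} (hα : IsIntegral ℤ α)
    (h : ∀ β : ℂ, IsConjRoot ℚ α β → ‖β‖ = 1) : ∃ m : ℕ, 0 < m ∧ α ^ m = 1 := by
  have hQ : IsIntegral ℚ α := hα.tower_top
  have : FiniteDimensional ℚ ℚ⟮α⟯ := adjoin.finiteDimensional hQ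
  have : NumberField ℚ⟮α⟯ := { to_charZero := inferInstance, to_finiteDimensional := this }
  have hgen : IsIntegral ℤ (AdjoinSimple.gen ℚ α) := by
    rw [← isIntegral_algebraMap_iff (algebraMap ℚ⟮α⟯ ℂ).injective,
      AdjoinSimple.algebraMap_gen]
    exact hα
  obtain ⟨m, hm, h1⟩ := NumberField.Embeddings.pow_eq_one_of_norm_eq_one ℚ⟮α⟯ ℂ hgen
    (fun φ => h _ (isConjRoot_map_gen φ hQ.isAlgebraic))
  refine ⟨m, hm, ?_⟩
  have := congrArg (algebraMap ℚ⟮α⟯ ℂ) h1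
  rwa [map_pow, AdjoinSimple.algebraMap_gen, map_one] at this

/-! ### Two digits -/

/-- In base `1` the digits `0, 1` would give no negative numbers, so this root of unity is treated
apart. -/
theorem isDigitSet_one_neg_one : IsDigitSet 1 {1, -1} := by
  have hmem : ∀ z ∈ Algebra.adjoin ℤ {(1 : ℂ)}, ∃ k : ℤ, z = k := fun z hz => by
    obtain ⟨p, rfl⟩ := mem_adjoin_iff_exists_aeval.1 hz
    refine ⟨p.eval 1, ?_⟩
    rw [← map_one (algebraMap ℤ ℂ), aeval_algebraMap_apply]
    simp
  refine isDigitSet_of_forall_mem (by simp [one_mem]) fun z hz => ?_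
  have hone : (1 : ℂ) ∈ digitSums (({1, -1} : Finset ℂ) : Set ℂ) 1 :=
    mem_digitSums_self (by simp)
  have hneg : (-1 : ℂ) ∈ digitSums (({1, -1} : Finset ℂ) : Set ℂ) 1 :=
    mem_digitSums_self (by simp)
  obtain ⟨k, rfl⟩ := hmem z hz
  induction k using Int.induction_on with
  | zero => simpa using add_mul_mem_digitSums (s := 1) (by simp) hneg
  | succ k ih =>
    have := add_mul_mem_digitSums (s := 1) (by simp) (ih (intCast_mem_adjoin 1 _))
    rw [one_mul, add_comm] at this
    simpa using this
  | pred k ih =>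
    have := add_mul_mem_digitSums (s := -1) (by simp) (ih (intCast_mem_adjoin 1 _))
    rw [one_mul, add_comm] at this
    simpa [sub_eq_add_neg] using this

/-- Sums of powers of a root of unity `α ≠ 1` make up all of `ℤ[α]`. -/
theorem isDigitSet_zero_one {α : ℂ} {m : ℕ} (hm : 0 < m) (hα : α ^ m = 1) (h1 : α ≠ 1) :
    IsDigitSet α {0, 1} := by
  set D := digitSums (({0, 1} : Finset ℂ) : Set ℂ) α with hD
  have h0S : (0 : ℂ) ∈ (({0, 1} : Finset ℂ) : Set ℂ) := by simp
  have h1S : (1 : ℂ) ∈ (({0, 1} : Finset ℂ) : Set ℂ) := by simp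
  have hmul : ∀ z ∈ D, α * z ∈ D := fun z hz => by
    simpa only [zero_add] using add_mul_mem_digitSums h0S hz
  have hpowmul : ∀ k : ℕ, ∀ z ∈ D, α ^ k * z ∈ D := fun k => by
    induction k with
    | zero => simp
    | succ k ih =>
      intro z hz
      rw [pow_succ, mul_assoc]
      exact ih _ (hmul z hz)
  have hinv : α * α ^ (m - 1) = 1 := by rw [← pow_succ', Nat.sub_add_cancel hm, hα]
  have hadd_one : ∀ z ∈ D, 1 + z ∈ D := fun z hz => by
    have := add_mul_mem_digitSums h1S (hpowmul (m - 1) z hz)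
    -- `α ^ (m - 1)` is the inverse of `α`, so `z` may be moved up one place: `1 + z = 1 + α * (α ^
    -- (m - 1) * z)`.
    rwa [← mul_assoc, hinv, one_mul] at this
  have hadd : ∀ z ∈ D, ∀ w ∈ D, z + w ∈ D := fun z hz => by
    refine digitSums_induction (P := fun z => ∀ w ∈ D, z + w ∈ D) (fun s hs w hw => ?_)
      (fun s hs y _ ih w hw => ?_) hz
    · have : s = 0 ∨ s = 1 := by simpa using hs
      rcases this with rfl | rfl
      · simpa using hw
      · exact hadd_one w hw
    · have hy := hmul _ (ih _ (hpowmul (m - 1) w hw))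
      have heq : α * (y + α ^ (m - 1) * w) = α * y + w := by
        linear_combination w * hinv
      rw [heq] at hy
      have : s = 0 ∨ s = 1 := by simpa using hs
      rcases this with rfl | rfl
      · simpa using hy
      · rw [add_assoc]
        exact hadd_one _ hy
  have hzero : (0 : ℂ) ∈ D := mem_digitSums_self h0S
  have hone : (1 : ℂ) ∈ D := mem_digitSums_self h1S
  have hsum : ∀ n : ℕ, ∑ j ∈ Finset.range n, α ^ (j + 1) ∈ D := fun n => by
    induction n with
    | zero => simpa using hzero
    | succ n ih =>
      rw [Finset.sum_range_succ]
      exact hadd _ ih _ (by simpa using hpowmul (n + 1) 1 hone)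
  -- As `α ≠ 1`, the sum of `α ^ j` over `j < m` vanishes, so `-1` is a sum of positive powers of
  -- `α`.
  have hnegone : (-1 : ℂ) ∈ D := by
    have hgeom : ∑ j ∈ Finset.range m, α ^ j = 0 := by
      rw [geom_sum_eq h1, hα, sub_self, zero_div]
    obtain ⟨n, rfl⟩ : ∃ n, m = n + 1 := ⟨m - 1, by omega⟩
    rw [Finset.sum_range_succ', pow_zero] at hgeom
    rw [← eq_neg_of_add_eq_zero_left hgeom]
    exact hsum n
  have hint : ∀ k : ℤ, (k : ℂ) ∈ D := fun k => by
    induction k using Int.induction_on with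
    | zero => simpa using hzero
    | succ k ih => simpa using hadd _ ih _ hone
    | pred k ih => simpa [sub_eq_add_neg] using hadd _ ih _ hnegone
  refine isDigitSet_of_forall_mem (by simp [zero_mem, one_mem]) fun z hz => ?_
  obtain ⟨p, rfl⟩ := mem_adjoin_iff_exists_aeval.1 hz
  clear hz
  induction p using Polynomial.induction_on' with
  | add p q hp hq =>
    rw [map_add]
    exact hadd _ hp _ hq
  | monomial n k =>
    rw [aeval_monomial, mul_comm]
    exact hpowmul n _ (hint k)

theorem mem_setF_two_of_pow_eq_one {α : ℂ} {m : ℕ} (hm : 0 < m) (hα : α ^ m = 1) :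
    α ∈ setF 2 := by
  have halg : IsAlgebraic ℚ α := by
    refine (IsIntegral.of_pow hm ?_).isAlgebraic
    rw [hα]
    exact isIntegral_one
  by_cases h1 : α = 1
  · subst h1
    have hcard : ({1, -1} : Finset ℂ).card = 2 := Finset.card_pair (by norm_num)
    exact ⟨halg, {1, -1}, ⟨isDigitSet_one_neg_one, fun T hT => hcard ▸ hT.two_le_card⟩, hcard⟩
  · have hcard : ({0, 1} : Finset ℂ).card = 2 := Finset.card_pair (by norm_num)
    exact ⟨halg, {0, 1}, ⟨isDigitSet_zero_one hm hα h1, fun T hT => hcard ▸ hT.two_le_card⟩,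
      hcard⟩

/-- Here `|M_α(0)| ≤ 2`. On the unit circle `|M_α(0)|` is the modulus of the leading coefficient,
and the value `1` means a root of unity. Outside, that modulus is positive and smaller than
`|M_α(0)|`, which leaves only `1` and `2`. -/
theorem setF_two_cases {α : ℂ} (h : α ∈ setF 2) :
    ((∀ β : ℂ, IsConjRoot ℚ α β → ‖β‖ = 1) ∨
      (IsExpandingInteger α ∧ |(primMinpoly α).eval 0| = 2)) ∧
    ((¬ ∃ m : ℕ, 0 < m ∧ α ^ m = 1) → |(primMinpoly α).eval 0| = 2) := by
  obtain ⟨hα, S, ⟨hS, -⟩, hcard⟩ := h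
  have hle := hS.natAbs_eval_zero_le_card hα
  rw [hcard] at hle
  have hle' : |(primMinpoly α).eval 0| ≤ 2 := by
    rw [Int.abs_eq_natAbs]
    exact_mod_cast hle
  have hl : 0 < |(primMinpoly α).leadingCoeff| :=
    abs_pos.2 (leadingCoeff_ne_zero.2 (primMinpoly_ne_zero α))
  rcases hS.forall_norm_eq_one_or_forall_one_lt_norm hα with h1 | h1
  · refine ⟨Or.inl h1, fun hroot => ?_⟩
    have heq := abs_eval_zero_eq_abs_leadingCoeff hα h1
    have hne : |(primMinpoly α).leadingCoeff| ≠ 1 := fun hone =>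
      hroot (exists_pow_eq_one_of_forall_isConjRoot (isIntegral_of_abs_leadingCoeff hα hone) h1)
    omega
  · have hlt := abs_leadingCoeff_lt_abs_eval_zero hα h1
    have h2 : |(primMinpoly α).eval 0| = 2 := by omega
    exact ⟨Or.inr ⟨⟨isIntegral_of_abs_leadingCoeff hα (by omega), h1⟩, h2⟩, fun _ => h2⟩

/-! ### Integer digits on the unit circle -/

/-- The elements of `ℤ[α] ∩ α⁻¹ ℤ[α⁻¹]` (for `α ≠ 0`). -/
def reciprocalPart (α : ℂ) : Set ℂ :=
  {z | z ∈ Algebra.adjoin ℤ {α} ∧ ∃ (n : ℕ) (q : ℤ[X]), q.degree < n ∧ z * α ^ n = aeval α q}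

theorem degree_mul_X_pow_lt {q : ℤ[X]} {n k : ℕ} (h : q.degree < n) :
    (q * X ^ k).degree < ((n + k : ℕ) : WithBot ℕ) := by
  rw [degree_lt_iff_coeff_zero] at h ⊢
  intro m hm
  rw [coeff_mul_X_pow', if_pos (by omega)]
  exact h _ (by omega)

namespace reciprocalPart

variable {α z w : ℂ}

theorem sub_mem (hz : z ∈ reciprocalPart α) (hw : w ∈ reciprocalPart α) :
    z - w ∈ reciprocalPart α := by
  obtain ⟨hz, n, q, hq, hzq⟩ := hz
  obtain ⟨hw, k, r, hr, hwr⟩ := hw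
  refine ⟨_root_.sub_mem hz hw, n + k, q * X ^ k - r * X ^ n, ?_, ?_⟩
  · refine (degree_sub_le _ _).trans_lt (max_lt (degree_mul_X_pow_lt hq) ?_)
    rw [add_comm n k]
    exact degree_mul_X_pow_lt hr
  · simp only [map_sub, map_mul, map_pow, aeval_X, ← hzq, ← hwr]
    ring

/-- `α⁻¹ ℤ[α⁻¹]` is stable under `z ↦ (z - s) / α` for integral `s`; this is where integrality of
the digits enters. -/
theorem of_intCast_add_mul {s : ℤ} (hz : (s : ℂ) + α * z ∈ reciprocalPart α)
    (hz' : z ∈ Algebra.adjoin ℤ {α}) : z ∈ reciprocalPart α := by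
  obtain ⟨-, n, q, hq, hzq⟩ := hz
  refine ⟨hz', n + 1, q - C s * X ^ n, ?_, ?_⟩
  · refine (degree_sub_le _ _).trans_lt (max_lt (hq.trans ?_) ?_)
    · exact_mod_cast n.lt_succ_self
    · exact (degree_C_mul_X_pow_le n s).trans_lt (by exact_mod_cast n.lt_succ_self)
  · simp only [map_sub, map_mul, map_pow, aeval_X, ← hzq, aeval_C_intCast]
    ring

/-- `k * X ^ n - q` is a multiple of `M_α` with leading coefficient `k`. -/
theorem leadingCoeff_dvd (hα : IsAlgebraic ℚ α) {k : ℤ} (hk : (k : ℂ) ∈ reciprocalPart α) :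
    (primMinpoly α).leadingCoeff ∣ k := by
  obtain ⟨-, n, q, hq, hkq⟩ := hk
  rcases eq_or_ne k 0 with rfl | hk0
  · exact dvd_zero _
  obtain ⟨r, hr⟩ := (aeval_eq_zero_iff_primMinpoly_dvd hα (C k * X ^ n - q)).1 (by simp [hkq])
  have hlead : (C k * X ^ n - q).leadingCoeff = k := by
    rw [leadingCoeff_sub_of_degree_lt (by rwa [degree_C_mul_X_pow n hk0]),
      leadingCoeff_C_mul_X_pow]
  rw [← hlead, hr, leadingCoeff_mul]
  exact dvd_mul_right _ _

theorem intCast_leadingCoeff_mul_mem (hα : IsAlgebraic ℚ α) (k : ℤ) :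
    (((primMinpoly α).leadingCoeff * k : ℤ) : ℂ) ∈ reciprocalPart α := by
  refine ⟨intCast_mem_adjoin α _, (primMinpoly α).natDegree, -(primMinpoly α).eraseLead * C k,
    ?_, ?_⟩
  · rw [neg_mul, degree_neg]
    refine
      ((degree_mul_le _ _).trans (add_le_of_nonpos_right degree_C_le)).trans_lt ?_
    rw [← degree_eq_natDegree (primMinpoly_ne_zero α)]
    exact degree_eraseLead_lt (primMinpoly_ne_zero α)
  · have h := congrArg (aeval α) (eraseLead_add_C_mul_X_pow (primMinpoly α))
    simp only [map_add, map_mul, map_pow, aeval_X, aeval_C_intCast,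
      aeval_primMinpoly hα] at h
    simp only [map_neg, map_mul, aeval_C_intCast, Int.cast_mul]
    linear_combination (k : ℂ) * h

theorem infinite (hα : IsAlgebraic ℚ α) : (reciprocalPart α).Infinite := by
  refine Set.infinite_of_injective_forall_mem (f := fun k : ℤ =>
    (((primMinpoly α).leadingCoeff * k : ℤ) : ℂ)) (fun k l hkl => ?_)
    (intCast_leadingCoeff_mul_mem hα)
  exact mul_left_cancel₀ (leadingCoeff_ne_zero.2 (primMinpoly_ne_zero α)) (Int.cast_injective hkl)

end reciprocalPart

/-- A point of the cycle of `a` already has a preimage on that cycle, so by injectivity no point of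
`A` enters the cycle from outside: `A` is the cycle. -/
theorem Set.Finite.of_injOn_of_forall_iterate_eq {X : Type*} {T : X → X} {A : Set X} {a : X}
    (hmaps : Set.MapsTo T A A) (hinj : Set.InjOn T A) (ha : a ∈ A)
    (hper : ∃ p, 0 < p ∧ T^[p] a = a) (h : ∀ x ∈ A, ∃ k, T^[k] x = a) : A.Finite := by
  obtain ⟨p, hp, hpa⟩ := hper
  have hper : Function.IsPeriodicPt T p a := hpa
  have horb : ∀ j, T^[j] a ∈ A := fun j => hmaps.iterate j ha
  have key : ∀ k, ∀ x ∈ A, T^[k] x = a → ∃ j, x = T^[j] a := fun k => by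
    induction k with
    | zero => exact fun x _ hx => ⟨0, hx⟩
    | succ k ih =>
      intro x hx hk
      obtain ⟨j, hj⟩ := ih (T x) (hmaps hx) (by rwa [Function.iterate_succ_apply] at hk)
      refine ⟨j + (p - 1), hinj hx (horb _) ?_⟩
      rw [hj, ← Function.iterate_succ_apply' T, Nat.succ_eq_add_one,
        show j + (p - 1) + 1 = j + p by omega, Function.iterate_add_apply, hpa]
  refine ((Finset.range p).finite_toSet.image fun j => T^[j] a).subset fun x hx => ?_
  obtain ⟨k, hk⟩ := h x hx
  obtain ⟨j, rfl⟩ := key k x hx hk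
  exact ⟨j % p, by simpa using Nat.mod_lt j hp, hper.iterate_mod_apply j⟩

theorem IsDigitSet.not_subset_range_intCast {α : ℂ} {S : Finset ℂ} (h : IsDigitSet α S)
    (hα : IsAlgebraic ℚ α) (hcard : S.card = ((primMinpoly α).eval 0).natAbs)
    (hlead : |(primMinpoly α).eval 0| = |(primMinpoly α).leadingCoeff|) :
    ¬ ((S : Set ℂ) ⊆ Set.range (fun k : ℤ => (k : ℂ))) := by
  intro hS
  have hα0 := h.ne_zero
  have hex : ∀ z : ℂ, ∃ s y : ℂ, z ∈ Algebra.adjoin ℤ {α} →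
      s ∈ S ∧ y ∈ Algebra.adjoin ℤ {α} ∧ z = s + α * y := fun z => by
    by_cases hz : z ∈ Algebra.adjoin ℤ {α}
    · obtain ⟨s, hs, y, hy, hzs⟩ := h.exists_eq_add_mul hz
      exact ⟨s, y, fun _ => ⟨hs, hy, hzs⟩⟩
    · exact ⟨0, 0, fun hz' => absurd hz' hz⟩
  choose d T hT using hex
  have hTeq : ∀ s ∈ S, ∀ y ∈ Algebra.adjoin ℤ {α}, T (s + α * y) = y := fun s hs y hy => by
    obtain ⟨hd, hTm, heq⟩ := hT (s + α * y)
      (add_mem (h.mem_adjoin hs) (Subalgebra.mul_mem _ (self_mem_adjoin α) hy))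
    have hds := h.eq_of_memSelfIdeal_sub hα hcard hs hd
      ⟨T (s + α * y) - y, sub_mem hTm hy, by linear_combination heq⟩
    refine mul_left_cancel₀ hα0 ?_
    linear_combination hds - heq
  -- The condition `0 < k` matters for `z = 0`: it makes `0` a periodic point of `T`.
  have hiter : ∀ z ∈ Algebra.adjoin ℤ {α}, ∃ k, 0 < k ∧ T^[k] z = 0 := fun z hz => by
    refine digitSums_induction (S := (S : Set ℂ)) (α := α)
      (P := fun z => ∃ k, 0 < k ∧ T^[k] z = 0) (fun s hs => ⟨1, one_pos, ?_⟩) ?_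
      (h.mem_digitSums hz)
    · simpa using hTeq s hs 0 (zero_mem _)
    · rintro s hs y hy ⟨k, hk, hk0⟩
      refine ⟨k + 1, k.succ_pos, ?_⟩
      rw [Function.iterate_succ_apply, hTeq s hs y
        (digitSums_subset_adjoin (fun r hr => h.mem_adjoin hr) hy), hk0]
  refine reciprocalPart.infinite hα (Set.Finite.of_injOn_of_forall_iterate_eq (T := T) (a := 0)
    ?_ ?_ ?_ ?_ ?_)
  · intro z hz
    obtain ⟨hd, hTm, heq⟩ := hT z hz.1
    obtain ⟨s, hs⟩ := hS (Finset.mem_coe.2 hd)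
    refine reciprocalPart.of_intCast_add_mul (s := s) ?_ hTm
    rw [show ((s : ℤ) : ℂ) = d z from hs, ← heq]
    exact hz
  -- If `T z = T w`, then `z - w` is a difference of integer digits lying in `reciprocalPart α`,
  -- hence a multiple of the leading coefficient, that is, of `M_α(0)`. So the two digits are
  -- congruent modulo `α` and coincide.
  · intro z hz w hw hzw
    obtain ⟨hd, hTm, heq⟩ := hT z hz.1
    obtain ⟨hd', -, heq'⟩ := hT w hw.1
    obtain ⟨s, hs⟩ := hS (Finset.mem_coe.2 hd)
    obtain ⟨t, ht⟩ := hS (Finset.mem_coe.2 hd')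
    dsimp only at hs ht
    have hsub : z - w = ((s - t : ℤ) : ℂ) := by
      push_cast
      rw [hs, ht]
      linear_combination heq - heq' + α * hzw
    have hdvd := reciprocalPart.leadingCoeff_dvd hα (hsub ▸ reciprocalPart.sub_mem hz hw)
    rw [← abs_dvd, ← hlead, abs_dvd, ← memSelfIdeal_intCast_iff hα] at hdvd
    push_cast at hdvd
    rw [hs, ht] at hdvd
    rw [heq, heq', hzw, h.eq_of_memSelfIdeal_sub hα hcard hd hd' hdvd]
  · simpa using reciprocalPart.intCast_leadingCoeff_mul_mem hα 0
  · exact hiter 0 (zero_mem _)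
  · intro z hz
    obtain ⟨k, -, hk⟩ := hiter z hz.1
    exact ⟨k, hk⟩

/-! ### Conjugates of modulus greater than `2`: descent on the house. -/

open IntermediateField in
/-- The house of the elements of `ℤ[α]`, if all conjugates of `α` have modulus greater than `2`. -/
theorem exists_house {α : ℂ} (hα : IsIntegral ℤ α)
    (h : ∀ β : ℂ, IsConjRoot ℚ α β → 2 < ‖β‖) :
    ∃ H : ℂ → ℝ,
      (∀ z ∈ Algebra.adjoin ℤ {α}, ∀ w ∈ Algebra.adjoin ℤ {α}, H (z - w) ≤ H z + H w) ∧
      (∀ y ∈ Algebra.adjoin ℤ {α}, y ≠ 0 → 2 * H y < H (α * y)) ∧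
      ∀ B : ℝ, {z | z ∈ Algebra.adjoin ℤ {α} ∧ H z ≤ B}.Finite := by
  have hQ : IsIntegral ℚ α := hα.tower_top
  have hfd : FiniteDimensional ℚ ℚ⟮α⟯ := adjoin.finiteDimensional hQ
  have : NumberField ℚ⟮α⟯ := { to_charZero := inferInstance, to_finiteDimensional := hfd }
  have hmem : ∀ z ∈ Algebra.adjoin ℤ {α}, z ∈ ℚ⟮α⟯ := fun z hz => by
    obtain ⟨p, rfl⟩ := mem_adjoin_iff_exists_aeval.1 hz
    have := aeval_algebraMap_apply ℂ (AdjoinSimple.gen ℚ α) p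
    rw [AdjoinSimple.algebraMap_gen] at this
    rw [this]
    exact (aeval (AdjoinSimple.gen ℚ α) p).2
  classical
  set H : ℂ → ℝ := fun z => if hz : z ∈ ℚ⟮α⟯ then NumberField.house (⟨z, hz⟩ : ℚ⟮α⟯) else 0
    with hH
  have hHx : ∀ x : ℚ⟮α⟯, H x = NumberField.house x := fun x => by simp [hH]
  refine ⟨H, fun z hz w hw => ?_, fun y hy hy0 => ?_, fun B => ?_⟩
  · lift z to ℚ⟮α⟯ using hmem z hz
    lift w to ℚ⟮α⟯ using hmem w hw
    have : ((z : ℂ) - w) = ((z - w : ℚ⟮α⟯) : ℂ) := rfl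
    rw [this, hHx, hHx, hHx]
    unfold NumberField.house
    rw [map_sub]
    exact norm_sub_le _ _
  · lift y to ℚ⟮α⟯ using hmem y hy
    have : α * (y : ℂ) = ((AdjoinSimple.gen ℚ α * y : ℚ⟮α⟯) : ℂ) := rfl
    rw [this, hHx, hHx]
    have hy0' : y ≠ 0 := fun h0 => hy0 (by simp [h0])
    -- An embedding at which `y` attains its house.
    obtain ⟨φ, -, hφ⟩ := Finset.exists_mem_eq_sup' Finset.univ_nonempty
      (fun φ : ℚ⟮α⟯ →+* ℂ => ‖φ y‖₊)
    rw [NumberField.house_eq_sup' y, hφ]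
    refine lt_of_lt_of_le ?_ (NumberField.norm_embedding_le_house _ φ)
    rw [map_mul, norm_mul, coe_nnnorm]
    exact mul_lt_mul_of_pos_right (h _ (isConjRoot_map_gen φ hQ.isAlgebraic))
      (norm_pos_iff.2 ((map_ne_zero φ).2 hy0'))
  · refine ((NumberField.Embeddings.finite_of_norm_le ℚ⟮α⟯ ℂ B).image
      (algebraMap ℚ⟮α⟯ ℂ)).subset ?_
    rintro z ⟨hz, hzB⟩
    have hzint : IsIntegral ℤ z := adjoin_le_integralClosure hα hz
    lift z to ℚ⟮α⟯ using hmem z hz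
    rw [hHx] at hzB
    exact ⟨z, ⟨(isIntegral_algebraMap_iff (algebraMap ℚ⟮α⟯ ℂ).injective).1 hzint,
      fun φ => (NumberField.norm_embedding_le_house _ φ).trans hzB⟩, rfl⟩

/-- The digits are representatives of the residue classes with minimal house. If `z = s + α * y`
with `y ≠ 0`, then `2 * H y < H (α * y) ≤ H z + H s ≤ 2 * H z`. Counting the elements of smaller
house turns this into a descent in `ℕ`. -/
theorem mem_setF_of_forall_two_lt_norm {α : ℂ} (hα : IsIntegral ℤ α)
    (h : ∀ β : ℂ, IsConjRoot ℚ α β → 2 < ‖β‖) :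
    α ∈ setF ((primMinpoly α).eval 0).natAbs := by
  have hQ : IsAlgebraic ℚ α := (hα.tower_top : IsIntegral ℚ α).isAlgebraic
  have hα0 : α ≠ 0 := fun h0 => by
    have := h α IsConjRoot.refl
    rw [h0, norm_zero] at this
    linarith
  obtain ⟨H, hsub, hmul, hfin⟩ := exists_house hα h
  set μ : ℂ → ℕ := fun z => {w | w ∈ Algebra.adjoin ℤ {α} ∧ H w < H z}.ncard with hμ
  have hfin' : ∀ z, {w | w ∈ Algebra.adjoin ℤ {α} ∧ H w < H z}.Finite := fun z =>
    (hfin (H z)).subset fun w hw => ⟨hw.1, hw.2.le⟩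
  have hμlt : ∀ w ∈ Algebra.adjoin ℤ {α}, ∀ z, H w < H z → μ w < μ z := fun w hw z hwz =>
    Set.ncard_lt_ncard ⟨fun v hv => ⟨hv.1, hv.2.trans hwz⟩,
      fun hle => lt_irrefl _ (hle (show w ∈ _ from ⟨hw, hwz⟩)).2⟩ (hfin' z)
  have hmin : ∀ k : ℕ, ∃ s, (s ∈ Algebra.adjoin ℤ {α} ∧ MemSelfIdeal α (s - k)) ∧
      ∀ z, z ∈ Algebra.adjoin ℤ {α} ∧ MemSelfIdeal α (z - k) → H s ≤ H z := fun k => by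
    obtain ⟨s, hs, hmin⟩ := (measure μ).wf.has_min
      {z | z ∈ Algebra.adjoin ℤ {α} ∧ MemSelfIdeal α (z - k)}
      ⟨k, natCast_mem _ k, 0, zero_mem _, by simp⟩
    exact ⟨s, hs, fun z hz => not_lt.1 fun hlt => hmin z hz (hμlt z hz.1 s hlt)⟩
  choose d hd hdmin using hmin
  classical
  have hset : IsDigitSet α ((Finset.range ((primMinpoly α).eval 0).natAbs).image d) := by
    refine isDigitSet_of_measure μ (fun s hs => ?_) fun z hz => ?_
    · obtain ⟨k, -, rfl⟩ := Finset.mem_image.1 hs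
      exact (hd k).1
    · obtain ⟨k, hk, hzk⟩ := exists_nat_memSelfIdeal_sub hQ hα0 hz
      obtain ⟨y, hy, hzy⟩ : MemSelfIdeal α (z - d k) := by simpa using hzk.sub (hd k).2
      refine ⟨d k, Finset.mem_image_of_mem d (Finset.mem_range.2 hk), y, hy,
        by linear_combination hzy, or_iff_not_imp_left.2 fun hy0 => hμlt y hy z ?_⟩
      have h1 := hmul y hy hy0
      rw [← hzy] at h1
      have h2 := hsub z hz (d k) (hd k).1
      have h3 := hdmin k z ⟨hz, hzk⟩
      linarith
  exact hset.mem_setF hQ (Finset.card_image_le.trans_eq (Finset.card_range _))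

/-! ### Rational bases -/

section Rational

variable {a : ℕ} {b : ℤ} {α : ℂ}

/-- `b * X - a` is a multiple of `M_α` with coprime coefficients, so the cofactor is `±1`. -/
theorem natAbs_eval_zero_primMinpoly_div (hb : b ≠ 0) (hab : Int.gcd (a : ℤ) b = 1)
    (hα : α = (a : ℂ) / (b : ℂ)) : IsAlgebraic ℚ α ∧ ((primMinpoly α).eval 0).natAbs = a := by
  have hbC : (b : ℂ) ≠ 0 := by exact_mod_cast hb
  have halg : IsAlgebraic ℚ α := by
    have : α = algebraMap ℚ ℂ ((a : ℚ) / (b : ℚ)) := by simp [hα]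
    rw [this]
    exact isAlgebraic_algebraMap _
  refine ⟨halg, ?_⟩
  obtain ⟨g, hg⟩ := (aeval_eq_zero_iff_primMinpoly_dvd halg (C b * X - C (a : ℤ))).1 (by
    simp only [map_sub, map_mul, aeval_C_intCast, aeval_X, hα, Int.cast_natCast]
    field_simp
    ring)
  have hne : C b * X - C (a : ℤ) ≠ 0 := fun h0 => by
    have := congrArg (fun p : ℤ[X] => p.coeff 1) h0
    simp at this
    exact hb this
  have hg0 : g ≠ 0 := fun h0 => hne (by rw [hg, h0, mul_zero])
  have hdeg : (primMinpoly α).natDegree + g.natDegree ≤ 1 := by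
    rw [← natDegree_mul (primMinpoly_ne_zero α) hg0, ← hg]
    rw [sub_eq_add_neg, ← C_neg]
    exact natDegree_linear_le
  have hdegM : (primMinpoly α).natDegree ≠ 0 := fun h0 => by
    obtain ⟨c, hc⟩ := natDegree_eq_zero.1 h0
    have hroot := aeval_primMinpoly halg
    rw [← hc, aeval_C_intCast, Int.cast_eq_zero] at hroot
    exact primMinpoly_ne_zero α (by rw [← hc, hroot, C_0])
  obtain ⟨c, rfl⟩ := natDegree_eq_zero.1 (show g.natDegree = 0 by omega)
  have h0 := congrArg (eval 0) hg
  have h1 := congrArg (fun p : ℤ[X] => p.coeff 1) hg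
  simp only [eval_sub, eval_mul, eval_C, eval_X, mul_zero, zero_sub] at h0
  simp only [coeff_sub, coeff_C_mul, coeff_X_one, mul_one, coeff_C, one_ne_zero, if_false,
    sub_zero, coeff_mul_C] at h1
  have hc : c ∣ 1 := by
    have := Int.dvd_coe_gcd (a := (a : ℤ)) (b := b) (c := c)
      ((dvd_neg.1 (h0 ▸ dvd_mul_left c _ : c ∣ -(a : ℤ)))) (h1 ▸ dvd_mul_left c _)
    rwa [hab] at this
  have hc1 : c.natAbs = 1 := Int.natAbs_of_isUnit (isUnit_of_dvd_one hc)
  have := congrArg Int.natAbs h0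
  rw [Int.natAbs_neg, Int.natAbs_natCast, Int.natAbs_mul, hc1, mul_one] at this
  exact this.symm

theorem exists_eq_div_pow_of_mem_adjoin (hb : b ≠ 0) (hα : α = (a : ℂ) / (b : ℂ)) {z : ℂ}
    (hz : z ∈ Algebra.adjoin ℤ {α}) : ∃ (k : ℕ) (u : ℤ), z = u / (b : ℂ) ^ k := by
  have hbC : (b : ℂ) ≠ 0 := by exact_mod_cast hb
  induction hz using Algebra.adjoin_induction with
  | mem x hx => exact ⟨1, a, by rw [Set.mem_singleton_iff.1 hx, hα]; simp⟩
  | algebraMap r => exact ⟨0, r, by simp⟩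
  | add x y _ _ hx hy =>
    obtain ⟨k, u, rfl⟩ := hx
    obtain ⟨l, v, rfl⟩ := hy
    refine ⟨k + l, u * b ^ l + v * b ^ k, ?_⟩
    push_cast
    field_simp
    ring
  | mul x y _ _ hx hy =>
    obtain ⟨k, u, rfl⟩ := hx
    obtain ⟨l, v, rfl⟩ := hy
    refine ⟨k + l, u * v, ?_⟩
    push_cast
    field_simp
    ring

/-- A criterion for finite sets of integers to be digit sets of the rational number `a / b`. -/
theorem isDigitSet_image_intCast (hb : b ≠ 0) (hab : Int.gcd (a : ℤ) b = 1)
    (hα : α = (a : ℂ) / (b : ℂ)) (D : Finset ℤ) (hD0 : 0 ∈ D)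
    (hD : ∀ u : ℤ, ∃ s ∈ D, (a : ℤ) ∣ u - s) (μ : ℤ → ℕ)
    (hμ : ∀ q : ℤ, q ≠ 0 → ∃ s ∈ D, ∃ q', b * q = s + a * q' ∧ μ q' < μ q) :
    IsDigitSet α (D.image fun k : ℤ => (k : ℂ)) := by
  have hbC : (b : ℂ) ≠ 0 := by exact_mod_cast hb
  have hmem : ∀ s ∈ D, (s : ℂ) ∈ ((D.image fun k : ℤ => (k : ℂ) : Finset ℂ) : Set ℂ) :=
    fun s hs => Finset.mem_coe.2 (Finset.mem_image_of_mem _ hs)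
  -- `b * q = s + a * q'` reads `b * q = s + α * (b * q')`: division acts on the multiples of `b` by
  -- `q ↦ q'`.
  have hmul : ∀ q : ℤ, ((b * q : ℤ) : ℂ) ∈ digitSums ((D.image fun k : ℤ => (k : ℂ) :
      Finset ℂ) : Set ℂ) α := fun q => by
    induction hn : μ q using Nat.strong_induction_on generalizing q with
    | _ n ih =>
      rcases eq_or_ne q 0 with rfl | hq
      · simpa only [mul_zero] using mem_digitSums_self (hmem 0 hD0)
      obtain ⟨s, hs, q', hqs, hlt⟩ := hμ q hq
      have := add_mul_mem_digitSums (hmem s hs) (ih _ (hn ▸ hlt) q' rfl)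
      convert this using 1
      rw [hqs, hα]
      push_cast
      field_simp
  have hdiv : ∀ (k : ℕ) (u : ℤ), (u : ℂ) / (b : ℂ) ^ k ∈ digitSums ((D.image fun k : ℤ =>
      (k : ℂ) : Finset ℂ) : Set ℂ) α := fun k => by
    induction k with
    | zero =>
      intro u
      obtain ⟨s, hs, q, hq⟩ := hD u
      have := add_mul_mem_digitSums (hmem s hs) (hmul q)
      convert this using 1
      rw [pow_zero, div_one, ← sub_add_cancel u s, hq, hα]
      push_cast
      field_simp
      ring
    | succ k ih =>
      intro u
      -- A digit `s` with `s * b ^ (k + 1)` congruent to `u` modulo `a` leaves a quotient with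
      -- denominator `b ^ k`.
      have hcop : IsCoprime (a : ℤ) (b ^ (k + 1)) :=
        IsCoprime.pow_right (Int.isCoprime_iff_gcd_eq_one.2 hab)
      obtain ⟨x, y, hxy⟩ := hcop
      obtain ⟨s, hs, q, hq⟩ := hD (u * y)
      have := add_mul_mem_digitSums (hmem s hs) (ih (u * x + b ^ (k + 1) * q))
      convert this using 1
      have hu : u = s * b ^ (k + 1) + a * (u * x + b ^ (k + 1) * q) := by
        linear_combination (-u) * hxy + (b ^ (k + 1)) * hq
      have huC : (u : ℂ) = s * (b : ℂ) ^ (k + 1) + a * ((u * x + b ^ (k + 1) * q : ℤ) : ℂ) := by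
        exact_mod_cast congrArg (Int.cast : ℤ → ℂ) hu
      rw [huC, hα]
      push_cast
      field_simp
      ring
  refine isDigitSet_of_forall_mem (fun s hs => ?_) fun z hz => ?_
  · obtain ⟨k, -, rfl⟩ := Finset.mem_image.1 hs
    exact intCast_mem_adjoin α k
  · obtain ⟨k, u, rfl⟩ := exists_eq_div_pow_of_mem_adjoin hb hα hz
    exact hdiv k u

/-- Digits `0, …, a - 1` for a negative base. -/
theorem exists_digits_of_neg (hb : b < 0) (hab' : |b| < (a : ℤ)) (hab : Int.gcd (a : ℤ) b = 1)
    (hα : α = (a : ℂ) / (b : ℂ)) :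
    ∃ D : Finset ℤ, 0 ∈ D ∧ D.card ≤ a ∧ IsDigitSet α (D.image fun k : ℤ => (k : ℂ)) := by
  rw [abs_of_neg hb] at hab'
  have ha : (0 : ℤ) < a := by omega
  refine ⟨Finset.Ico 0 (a : ℤ), by simpa using ha, by simp, ?_⟩
  refine isDigitSet_image_intCast hb.ne hab hα _ (by simpa using ha) (fun u => ?_)
    -- From `q > 0` the step may lead to `-q`; the extra `1` makes this a decrease. From `q < 0` the
    -- modulus itself drops.
    (fun q => 2 * q.natAbs + if 0 < q then 1 else 0) fun q hq => ?_
  · exact ⟨u % a, Finset.mem_Ico.2 ⟨Int.emod_nonneg _ ha.ne', Int.emod_lt_of_pos _ ha⟩,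
      Int.dvd_self_sub_emod⟩
  · have h0 := Int.emod_nonneg (b * q) ha.ne'
    have h1 := Int.emod_lt_of_pos (b * q) ha
    have h2 := Int.emod_add_mul_ediv (b * q) a
    set s := b * q % a
    set q' := b * q / a
    refine ⟨s, Finset.mem_Ico.2 ⟨h0, h1⟩, q', h2.symm, ?_⟩
    rcases lt_or_gt_of_ne hq with hq | hq
    · have hpos : 0 ≤ q' := by
        by_contra! hneg
        nlinarith [mul_pos_of_neg_of_neg hb hq]
      have hlt : q' < -q := by
        by_contra! hge
        nlinarith
      rw [if_neg (by omega : ¬ 0 < q)]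
      split_ifs <;> omega
    · have hneg : q' ≤ 0 := by
        by_contra! hpos
        nlinarith
      have hge : -q ≤ q' := by
        by_contra! hlt
        nlinarith
      rw [if_pos hq, if_neg (by omega : ¬ 0 < q')]
      omega

/-- The only obstruction is a fixed point `q' = q`, which means `s = -(a - b) * q`. -/
theorem natAbs_lt_natAbs_of_pos (hb : 0 < b) (hba : b < (a : ℤ)) {q q' s : ℤ} (hq : 0 < q)
    (hs : |s| < (a : ℤ)) (h : b * q = s + a * q') (hs' : 0 ≤ s ∨ ¬ (a - b : ℤ) ∣ s) :
    q'.natAbs < q.natAbs := by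
  obtain ⟨hs1, hs2⟩ := abs_lt.1 hs
  have hq'0 : 0 ≤ q' := by
    by_contra! hneg
    nlinarith
  have hlt : q' < q := by
    by_contra! hge
    have hs0 : s < 0 := by nlinarith
    have hq' : q' = q := by
      by_contra! hne
      have : q + 1 ≤ q' := by omega
      nlinarith
    refine hs'.resolve_left hs0.not_ge ⟨-q, ?_⟩
    rw [hq'] at h
    linear_combination -h
  omega

/-- For `0 < b < a` the division with remainder of `b q` by `a` makes `|q|` smaller, unless the
remainder has the sign opposite to that of `q` and is a multiple of `a - b`. -/
theorem natAbs_lt_natAbs_of_eq_add_mul (hb : 0 < b) (hba : b < (a : ℤ)) {q q' s : ℤ} (hq : q ≠ 0)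
    (hs : |s| < (a : ℤ)) (h : b * q = s + a * q') (hs' : 0 ≤ s * q ∨ ¬ (a - b : ℤ) ∣ s) :
    q'.natAbs < q.natAbs := by
  rcases lt_or_gt_of_ne hq with hq | hq
  · have := natAbs_lt_natAbs_of_pos hb hba (q := -q) (q' := -q') (s := -s) (by omega)
      (by rwa [abs_neg]) (by linear_combination -h) (hs'.imp (fun h => ?_) (by simp))
    · simpa using this
    · by_contra! hpos
      nlinarith
  · exact natAbs_lt_natAbs_of_pos hb hba hq hs h
      (hs'.imp_left fun h => nonneg_of_mul_nonneg_left h hq)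

theorem isDigitSet_image_of_pos (hb : 0 < b) (hba : b < (a : ℤ)) (hab : Int.gcd (a : ℤ) b = 1)
    (hα : α = (a : ℂ) / (b : ℂ)) (D : Finset ℤ) (hD0 : 0 ∈ D) (hDa : ∀ s ∈ D, |s| < (a : ℤ))
    (hD : ∀ u q : ℤ, ∃ s ∈ D, (a : ℤ) ∣ u - s ∧ (0 ≤ s * q ∨ ¬ (a - b : ℤ) ∣ s)) :
    IsDigitSet α (D.image fun k : ℤ => (k : ℂ)) := by
  refine isDigitSet_image_intCast hb.ne' hab hα D hD0 (fun u => ?_) Int.natAbs fun q hq => ?_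
  · obtain ⟨s, hs, hdvd, -⟩ := hD u 0
    exact ⟨s, hs, hdvd⟩
  · obtain ⟨s, hs, ⟨q', hq'⟩, h⟩ := hD (b * q) q
    have heq : b * q = s + a * q' := by linear_combination hq'
    exact ⟨s, hs, q', heq, natAbs_lt_natAbs_of_eq_add_mul hb hba hq (hDa s hs) heq h⟩

/-- No nonzero digit may be a multiple of `a - b`, so each residue `r ≠ 0` that is one is replaced
by `r - a`. This helps because `a - b` is coprime to `a` and differs from `1`, hence does not divide
`a`. -/
theorem exists_digits_of_pos (hb : 0 < b) (hba : b < (a : ℤ)) (hab : Int.gcd (a : ℤ) b = 1)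
    (hα : α = (a : ℂ) / (b : ℂ)) (hne : (a : ℤ) ≠ b + 1) :
    ∃ D : Finset ℤ, 0 ∈ D ∧ D.card ≤ a ∧ IsDigitSet α (D.image fun k : ℤ => (k : ℂ)) := by
  have ha : (0 : ℤ) < a := by omega
  have hδ : ¬ (a - b : ℤ) ∣ a := fun hdvd => by
    have hdb : (a - b : ℤ) ∣ b := by simpa using dvd_sub hdvd (dvd_refl (a - b : ℤ))
    have := Int.dvd_coe_gcd hdvd hdb
    rw [hab] at this
    have := Int.le_of_dvd one_pos this
    omega
  set f : ℤ → ℤ := fun r => if (a - b : ℤ) ∣ r ∧ r ≠ 0 then r - a else r with hf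
  have hfs : ∀ r, (0 ≤ f r ∧ f r = 0) ∨ ¬ (a - b : ℤ) ∣ f r := fun r => by
    by_cases hr0 : r = 0
    · left; simp [hf, hr0]
    · right
      by_cases hr : (a - b : ℤ) ∣ r
      · simp only [hf, hr, hr0, ne_eq, not_false_eq_true, and_self, if_true]
        exact fun h => hδ (by simpa using dvd_sub hr h)
      · simp [hf, hr]
  have hfa : ∀ r : ℤ, 0 ≤ r → r < a → |f r| < (a : ℤ) := fun r h0 h1 => by
    rw [abs_lt]
    simp only [hf]
    split_ifs with h
    · have := h.2
      omega
    · omega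
  refine ⟨(Finset.Ico 0 (a : ℤ)).image f,
    Finset.mem_image.2 ⟨0, Finset.mem_Ico.2 ⟨le_rfl, ha⟩, by simp [hf]⟩,
    Finset.card_image_le.trans_eq (by simp),
    isDigitSet_image_of_pos hb hba hab hα _
      (Finset.mem_image.2 ⟨0, Finset.mem_Ico.2 ⟨le_rfl, ha⟩, by simp [hf]⟩) (fun s hs => ?_)
      fun u q => ?_⟩
  · obtain ⟨r, hr, rfl⟩ := Finset.mem_image.1 hs
    exact hfa r (Finset.mem_Ico.1 hr).1 (Finset.mem_Ico.1 hr).2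
  · refine ⟨f (u % a), Finset.mem_image_of_mem f (Finset.mem_Ico.2
      ⟨Int.emod_nonneg _ ha.ne', Int.emod_lt_of_pos _ ha⟩), ?_,
      (hfs _).imp_left fun h => by rw [h.2, zero_mul]⟩
    have h1 : (a : ℤ) ∣ u - u % a := Int.dvd_self_sub_emod
    simp only [hf]
    split_ifs
    · rw [← sub_add]
      exact dvd_add h1 dvd_rfl
    · exact h1

/-- If `α = (b + 1) / b`, then every nonzero residue class modulo `α` contains two digits. -/
theorem IsDigitSet.two_mul_sub_one_le_card {S : Finset ℂ} (h : IsDigitSet α S) (hb : b ≠ 0)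
    (hab : Int.gcd (a : ℤ) b = 1) (hα : α = (a : ℂ) / (b : ℂ)) (hne : (a : ℤ) = b + 1) :
    2 * a - 1 ≤ S.card := by
  have hbC : (b : ℂ) ≠ 0 := by exact_mod_cast hb
  obtain ⟨halg, hN⟩ := natAbs_eval_zero_primMinpoly_div hb hab hα
  have haC : (a : ℂ) = b + 1 := by exact_mod_cast congrArg (Int.cast : ℤ → ℂ) hne
  have hex : ∀ z : ℂ, ∃ k : ℕ, z ∈ Algebra.adjoin ℤ {α} → k < a ∧ MemSelfIdeal α (z - k) :=
    fun z => by
      by_cases hz : z ∈ Algebra.adjoin ℤ {α}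
      · obtain ⟨k, hk, hzk⟩ := exists_nat_memSelfIdeal_sub halg h.ne_zero hz
        exact ⟨k, fun _ => ⟨hN ▸ hk, hzk⟩⟩
      · exact ⟨0, fun hz' => absurd hz' hz⟩
  choose c hc using hex
  have hclass : ∀ s ∈ S, ∀ k < a, MemSelfIdeal α (s - k) → c s = k := fun s hs k hk hsk => by
    obtain ⟨hlt, hsc⟩ := hc s (h.mem_adjoin hs)
    refine natCast_eq_of_memSelfIdeal_sub halg (hN.symm ▸ hlt) (hN.symm ▸ hk) ?_
    simpa using hsk.sub hsc
  rw [Finset.card_eq_sum_card_fiberwise (f := c) (t := Finset.range a)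
    (fun s hs => by simpa using (hc s (h.mem_adjoin hs)).1)]
  have hfib : ∀ k ∈ Finset.range a, (if k = 0 then 1 else 2) ≤ (S.filter fun s => c s = k).card :=
    fun k hk => by
      have hka := Finset.mem_range.1 hk
      obtain ⟨s, hs, hsk⟩ := h.exists_memSelfIdeal_sub (natCast_mem _ k)
      have hsmem : s ∈ S.filter fun s => c s = k :=
        Finset.mem_filter.2 ⟨hs, hclass s hs k hka hsk⟩
      split_ifs with hk0
      · exact Finset.card_pos.2 ⟨s, hsmem⟩
      · by_contra! hlt
        have huniq : ∀ t ∈ S, MemSelfIdeal α (t - s) → t = s := fun t ht hts =>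
          Finset.card_le_one.1 (by omega) t (Finset.mem_filter.2 ⟨ht, hclass t ht k hka
            (by simpa using hts.add hsk)⟩) s hsmem
        -- Since `1 - α = -1 / b`, the fixed point `s / (1 - α)` is `-b * s`.
        have hz := h.eq_zero_of_eq_add_mul_self (z := -b * s)
          (Subalgebra.mul_mem _ (neg_mem (intCast_mem_adjoin α b)) (h.mem_adjoin hs))
          (by rw [hα, haC]; field_simp; ring) huniq
        have hs0 : s = 0 := (mul_eq_zero.1 hz).resolve_left (neg_ne_zero.2 hbC)
        rw [hs0] at hsk
        refine hk0 (natCast_eq_of_memSelfIdeal_sub halg (hN.symm ▸ hka) (l := 0) ?_ ?_)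
        · omega
        · simpa using hsk.neg
  refine le_trans (le_of_eq ?_) (Finset.sum_le_sum hfib)
  rcases a with _ | n
  · simp
  · rw [Finset.sum_range_succ']
    simp
    omega

theorem rational_base_mem_setF (hb : 1 ≤ |b|) (hba : |b| < (a : ℤ)) (hab : Int.gcd (a : ℤ) b = 1)
    (hα : α = (a : ℂ) / (b : ℂ)) :
    ((a : ℤ) ≠ b + 1 → α ∈ setF ((primMinpoly α).eval 0).natAbs) ∧
    ((a : ℤ) = b + 1 → α ∈ setF (2 * ((primMinpoly α).eval 0).natAbs - 1)) ∧
    ∃ S : Finset ℂ, IsOptimalDigitSet α S ∧ (0 : ℂ) ∈ S ∧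
      (S : Set ℂ) ⊆ Set.range (fun k : ℤ => (k : ℂ)) := by
  have hb0 : b ≠ 0 := abs_pos.1 (by omega)
  obtain ⟨halg, hN⟩ := natAbs_eval_zero_primMinpoly_div hb0 hab hα
  have hrange : ∀ D : Finset ℤ, ((D.image fun k : ℤ => (k : ℂ) : Finset ℂ) : Set ℂ) ⊆
      Set.range (fun k : ℤ => (k : ℂ)) := fun D => by
    rw [Finset.coe_image]
    exact Set.image_subset_range _ _
  have hzero : ∀ D : Finset ℤ, 0 ∈ D → (0 : ℂ) ∈ D.image fun k : ℤ => (k : ℂ) := fun D hD =>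
    Finset.mem_image.2 ⟨0, hD, Int.cast_zero⟩
  by_cases hne : (a : ℤ) = b + 1
  · have hbpos : 0 < b := by
      by_contra! hle
      rw [abs_of_nonpos hle] at hb hba
      omega
    have ha : (0 : ℤ) < a := by omega
    -- Each nonzero class modulo `a` has one positive and one negative digit; the one with the sign
    -- of `q` avoids the fixed points.
    have hset : IsDigitSet α ((Finset.Ioo (-a : ℤ) a).image fun k : ℤ => (k : ℂ)) := by
      refine isDigitSet_image_of_pos hbpos (by omega) hab hα _
        (Finset.mem_Ioo.2 ⟨by omega, ha⟩)
        (fun s hs => abs_lt.2 (Finset.mem_Ioo.1 hs)) fun u q => ?_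
      rcases le_total 0 q with hq | hq
      · have h0 := Int.emod_nonneg u ha.ne'
        have h1 := Int.emod_lt_of_pos u ha
        exact ⟨u % a, Finset.mem_Ioo.2 ⟨by omega, h1⟩, Int.dvd_self_sub_emod,
          Or.inl (mul_nonneg h0 hq)⟩
      · have h0 := Int.emod_nonneg (-u) ha.ne'
        have h1 := Int.emod_lt_of_pos (-u) ha
        refine ⟨-(-u % a), Finset.mem_Ioo.2 ⟨by omega, by omega⟩, ?_,
          Or.inl (mul_nonneg_of_nonpos_of_nonpos (by omega) hq)⟩
        obtain ⟨t, ht⟩ : (a : ℤ) ∣ -u - -u % a := Int.dvd_self_sub_emod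
        exact ⟨-t, by linear_combination -ht⟩
    have hcard : ((Finset.Ioo (-a : ℤ) a).image fun k : ℤ => (k : ℂ)).card = 2 * a - 1 := by
      rw [Finset.card_image_of_injective _ Int.cast_injective, Int.card_Ioo]
      omega
    have hopt : IsOptimalDigitSet α ((Finset.Ioo (-a : ℤ) a).image fun k : ℤ => (k : ℂ)) :=
      ⟨hset, fun T hT => hcard ▸ hT.two_mul_sub_one_le_card hb0 hab hα hne⟩
    exact ⟨fun h => absurd hne h, fun _ => ⟨halg, _, hopt, hN.symm ▸ hcard⟩, _, hopt,
      hzero _ (Finset.mem_Ioo.2 ⟨by omega, ha⟩), hrange _⟩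
  · obtain ⟨D, hD0, hDcard, hD⟩ : ∃ D : Finset ℤ, 0 ∈ D ∧ D.card ≤ a ∧
        IsDigitSet α (D.image fun k : ℤ => (k : ℂ)) := by
      rcases lt_or_gt_of_ne hb0 with hneg | hpos
      · exact exists_digits_of_neg hneg hba hab hα
      · exact exists_digits_of_pos hpos (by rwa [abs_of_pos hpos] at hba) hab hα hne
    have hcard : (D.image fun k : ℤ => (k : ℂ)).card ≤ ((primMinpoly α).eval 0).natAbs :=
      hN.symm ▸ Finset.card_image_le.trans hDcard
    exact ⟨fun _ => hD.mem_setF halg hcard, fun h => absurd h hne, _,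
      hD.isOptimalDigitSet halg hcard, hzero D hD0, hrange D⟩

end Rational

theorem theorem2 :
    -- (i)
    ((∀ α : ℂ, (∃ m : ℕ, 0 < m ∧ α ^ m = 1) → α ∈ setF 2) ∧
      (∀ α : ℂ, α ∈ setF 2 →
        ((∀ β : ℂ, IsConjRoot ℚ α β → ‖β‖ = 1) ∨
          (IsExpandingInteger α ∧ |(primMinpoly α).eval 0| = 2)) ∧
        ((¬ ∃ m : ℕ, 0 < m ∧ α ^ m = 1) → |(primMinpoly α).eval 0| = 2))) ∧
    -- (ii)
    (∀ α : ℂ, IsAlgebraic ℚ α → |(primMinpoly α).eval 1| = 1 →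
      α ∉ setF ((primMinpoly α).eval 0).natAbs) ∧
    -- (iii)
    (∀ α : ℂ, IsAlgebraic ℚ α → (∀ β : ℂ, IsConjRoot ℚ α β → ‖β‖ = 1) →
      ∀ S : Finset ℂ, IsOptimalDigitSet α S → S.card = ((primMinpoly α).eval 0).natAbs →
        ¬ ((S : Set ℂ) ⊆ Set.range (fun k : ℤ => (k : ℂ)))) ∧
    -- (iv)
    (∀ α : ℂ, IsIntegral ℤ α → (∀ β : ℂ, IsConjRoot ℚ α β → 2 < ‖β‖) →
      α ∈ setF ((primMinpoly α).eval 0).natAbs) ∧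
    -- (v)
    (∀ (a : ℕ) (b : ℤ) (α : ℂ), 1 ≤ |b| → |b| < (a : ℤ) → Int.gcd (a : ℤ) b = 1 →
      α = (a : ℂ) / (b : ℂ) →
        ((a : ℤ) ≠ b + 1 → α ∈ setF ((primMinpoly α).eval 0).natAbs) ∧
        ((a : ℤ) = b + 1 → α ∈ setF (2 * ((primMinpoly α).eval 0).natAbs - 1)) ∧
        ∃ S : Finset ℂ, IsOptimalDigitSet α S ∧ (0 : ℂ) ∈ S ∧
          (S : Set ℂ) ⊆ Set.range (fun k : ℤ => (k : ℂ))) := by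
  refine ⟨⟨fun α ⟨m, hm, h⟩ => mem_setF_two_of_pow_eq_one hm h, fun α h => setF_two_cases h⟩,
    ?_, ?_, fun α hα h => mem_setF_of_forall_two_lt_norm hα h,
    fun a b α hb hba hab hα => rational_base_mem_setF hb hba hab hα⟩
  · rintro α hα h1 ⟨-, S, hS, hcard⟩
    exact hS.1.card_ne_of_natAbs_eval_one hα h1 hcard
  · intro α hα h S hS hcard
    exact hS.1.not_subset_range_intCast hα hcard (abs_eval_zero_eq_abs_leadingCoeff hα h)
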